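/- Let $\Gamma$ be a finite subgroup of $\mathrm{SL}_3(\mathbb{C})$, let $\gamma_0,\dots,\gamma_l$ be representatives of the equivalence classes of irreducible finite-dimensional complex representations of $\Gamma$, with $\gamma_0$ trivial, and let $\chi_i$ be the character of $\gamma_i$. For $m,n\ge 0$ let $\pi_{m,n}$ be the irreducible rational representation of $\mathrm{SL}_3(\mathbb{C})$ of highest weight $m\varpi_1+n\varpi_2$ (where $\varpi_1,\varpi_2$ are the fundamental weights, so that $\pi_{1,0}$ is the natural representation and $\pi_{0,1}$ its dual). Let $m_i(m,n)$ be the multiplicity of $\gamma_i$ in the restriction $\pi_{m,n}|_\Gamma$, so that $\pi_{m,n}|_\Gamma\cong\bigoplus_{i=0}^l \gamma_i^{\oplus m_i(m,n)}$; put $v_{m,n}=(m_0(m,n),\dots,m_l(m,n))$, so that $v_{0,0}=(1,0,\dots,0)$, and $$P_\Gamma(t,u)=\sum_{m,n\ge0}v_{m,n}\,t^mu^n\in\mathbb{C}[[t,u]]^{l+1}.$$ Then every coordinate $P_\Gamma(t,u)_i$ is a rational function of $t$ and $u$: there are polynomials $N,D\in\mathbb{C}[t,u]$, $D\neq0$,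 with $D\,P_\Gamma(t,u)_i=N$. More precisely, $\Gamma$ has exactly $l+1$ conjugacy classes. Let $g_0,\dots,g_l$ be representatives of them, let $\chi(g)=\operatorname{tr}(g)$ be the character of the natural representation of $\Gamma$ on $\mathbb{C}^3$, let $T_\Gamma=(\chi_i(g_j))_{i,j}$ be the character table, and let $\Delta(t,u)$ be the diagonal matrix over $\mathbb{C}(t,u)$ with entries $$\Delta(t,u)_{jj}=\frac{1-tu}{\bigl(1-t\,\overline{\chi(g_j)}+t^2\chi(g_j)-t^3\bigr)\bigl(1-u\,\chi(g_j)+u^2\,\overline{\chi(g_j)}-u^3\bigr)}.$$ Then $T_\Gamma$ is invertible and, in the field of fractions of $\mathbb{C}[[t,u]]$ (which contains $\mathbb{C}(t,u)$), $$P_\Gamma(t,u)=T_\Gamma\,\Delta(t,u)\,T_\Gamma^{-1}v_{0,0}=\bigl(T_\Gamma\,\Delta(t,u)\,T_\Gamma\bigr)\bigl(T_\Gamma^{-2}v_{0,0}\bigr).$$ -/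

import Mathlib

open scoped MatrixGroups

noncomputable section

/-- A rational (algebraic) representation of `SL₃(ℂ)`: every matrix coefficient is a polynomial
in the entries of the group element. -/
def IsRationalRep {W : Type*} [AddCommGroup W] [Module ℂ W]
    (π : Representation ℂ SL(3, ℂ) W) : Prop :=
  ∀ (w : W) (φ : Module.Dual ℂ W), ∃ p : MvPolynomial (Fin 3 × Fin 3) ℂ,
    ∀ g : SL(3, ℂ), φ (π g w) = MvPolynomial.eval (fun ij => g.1 ij.1 ij.2) p

/-- `w` is a highest weight vector of weight `m ϖ₁ + n ϖ₂`: it is nonzero and the Borel subgroup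
of upper triangular matrices acts on it through the character `b ↦ b₀₀ ^ m * (b₀₀ * b₁₁) ^ n`
(in particular unipotent upper triangular matrices fix it). -/
def IsHighestWeightVector {W : Type*} [AddCommGroup W] [Module ℂ W]
    (π : Representation ℂ SL(3, ℂ) W) (m n : ℕ) (w : W) : Prop :=
  w ≠ 0 ∧ ∀ b : SL(3, ℂ), (∀ i j : Fin 3, j < i → b.1 i j = 0) →
    π b w = (b.1 0 0 ^ m * (b.1 0 0 * b.1 1 1) ^ n) • w

/-- `π` is (a model of) the simple representation of `SL₃(ℂ)` of highest weight
`m ϖ₁ + n ϖ₂`. -/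
structure IsSimpleOfHighestWeight {W : Type*} [AddCommGroup W] [Module ℂ W]
    (π : Representation ℂ SL(3, ℂ) W) (m n : ℕ) : Prop where
  finiteDimensional : FiniteDimensional ℂ W
  rational : IsRationalRep π
  irreducible : π.IsIrreducible
  exists_highestWeightVector : ∃ w : W, IsHighestWeightVector π m n w

/-- `γ₀, …, γ_l` is a list of representatives, without repetition, of all the equivalence classes
of irreducible finite dimensional complex representations of `G`, and `γ₀` is trivial. -/
structure IsIrrepList {G : Type*} [Group G] {l : ℕ} {U : Fin (l + 1) → Type*}
    [∀ i, AddCommGroup (U i)] [∀ i, Module ℂ (U i)]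
    (γ : ∀ i, Representation ℂ G (U i)) : Prop where
  finiteDimensional : ∀ i, FiniteDimensional ℂ (U i)
  irreducible : ∀ i, (γ i).IsIrreducible
  injective : ∀ i j, Nonempty ((γ i).Equiv (γ j)) → i = j
  exhaustive : ∀ (d : ℕ) (σ : Representation ℂ G (Fin d → ℂ)), σ.IsIrreducible →
    ∃ i, Nonempty (σ.Equiv (γ i))
  trivial_zero : (γ 0).IsTrivial

/-- The restriction to the subgroup `Γ` of a representation of `SL₃(ℂ)`. -/
def restrictRep (Γ : Subgroup SL(3, ℂ)) {W : Type*} [AddCommGroup W] [Module ℂ W]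
    (π : Representation ℂ SL(3, ℂ) W) : Representation ℂ Γ W :=
  π.comp Γ.subtype

/-- The multiplicity `dim Hom_G(σ, ρ)` of an irreducible complex representation `σ` in `ρ`. -/
def repMultiplicity {G : Type*} [Group G] {U W : Type*} [AddCommGroup U] [Module ℂ U]
    [AddCommGroup W] [Module ℂ W]
    (σ : Representation ℂ G U) (ρ : Representation ℂ G W) : ℕ :=
  Module.finrank ℂ (Representation.IntertwiningMap σ ρ)

/-- The vector `v_{m,n} = (m_0(m,n), …, m_l(m,n))` of the multiplicities of the `γ i` in the
restriction of `π m n` to `Γ`. -/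
def multVector (Γ : Subgroup SL(3, ℂ)) {l : ℕ} {U : Fin (l + 1) → Type*}
    [∀ i, AddCommGroup (U i)] [∀ i, Module ℂ (U i)] (γ : ∀ i, Representation ℂ Γ (U i))
    {V : ℕ → ℕ → Type*} [∀ m n, AddCommGroup (V m n)] [∀ m n, Module ℂ (V m n)]
    (π : ∀ m n, Representation ℂ SL(3, ℂ) (V m n)) (m n : ℕ) (i : Fin (l + 1)) : ℕ :=
  repMultiplicity (γ i) (restrictRep Γ (π m n))

/-- The power series `P_Γ(t, u)_i = ∑ m_i(m, n) t ^ m u ^ n`; the variables `t` and `u` are those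
of index `0` and `1`. -/
def multSeries (Γ : Subgroup SL(3, ℂ)) {l : ℕ} {U : Fin (l + 1) → Type*}
    [∀ i, AddCommGroup (U i)] [∀ i, Module ℂ (U i)] (γ : ∀ i, Representation ℂ Γ (U i))
    {V : ℕ → ℕ → Type*} [∀ m n, AddCommGroup (V m n)] [∀ m n, Module ℂ (V m n)]
    (π : ∀ m n, Representation ℂ SL(3, ℂ) (V m n)) (i : Fin (l + 1)) :
    MvPowerSeries (Fin 2) ℂ :=
  fun s => (multVector Γ γ π (s 0) (s 1) i : ℂ)

/-- A power series in `t, u` is a rational function if it is a quotient `N / D` of polynomials. -/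
def IsRationalSeries (P : MvPowerSeries (Fin 2) ℂ) : Prop :=
  ∃ N D : MvPolynomial (Fin 2) ℂ, D ≠ 0 ∧ (D : MvPowerSeries (Fin 2) ℂ) * P = N

/-- The field `ℂ(t, u)`. -/
abbrev RatFun2 : Type := FractionRing (MvPolynomial (Fin 2) ℂ)

/-- The field of fractions of `ℂ⟦t, u⟧`. -/
abbrev SeriesFrac2 : Type := FractionRing (MvPowerSeries (Fin 2) ℂ)

theorem coeToMvPowerSeries_injective :
    Function.Injective
      (MvPolynomial.coeToMvPowerSeries.ringHom : MvPolynomial (Fin 2) ℂ →+* _) :=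
  MvPolynomial.coe_injective (Fin 2) ℂ

instance : IsDomain (MvPowerSeries (Fin 2) ℂ) := NoZeroDivisors.to_isDomain _

/-- The embedding of `ℂ(t, u)` into the field of fractions of `ℂ⟦t, u⟧`. -/
def ratFunToSeriesFrac : RatFun2 →+* SeriesFrac2 :=
  IsFractionRing.map coeToMvPowerSeries_injective

/-- The rational function
`f(d₁, d₂) = (1 - t u) / ((1 - t d₁ + t² d₂ - t³) (1 - u d₂ + u² d₁ - u³))`. -/
def ratF (d₁ d₂ : ℂ) : RatFun2 :=
  let t : RatFun2 := algebraMap (MvPolynomial (Fin 2) ℂ) RatFun2 (MvPolynomial.X 0)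
  let u : RatFun2 := algebraMap (MvPolynomial (Fin 2) ℂ) RatFun2 (MvPolynomial.X 1)
  let c : ℂ → RatFun2 := algebraMap ℂ RatFun2
  (1 - t * u) /
    ((1 - t * c d₁ + t ^ 2 * c d₂ - t ^ 3) * (1 - u * c d₂ + u ^ 2 * c d₁ - u ^ 3))

/-- The character of the natural three dimensional representation of `Γ`. -/
def naturalCharacter (Γ : Subgroup SL(3, ℂ)) (g : Γ) : ℂ := g.1.1.trace

/-- The character table `T_{ij} = χ_i(g_j)`. -/
def charTable {G : Type*} [Group G] {l : ℕ} {U : Fin (l + 1) → Type*}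
    [∀ i, AddCommGroup (U i)] [∀ i, Module ℂ (U i)] (γ : ∀ i, Representation ℂ G (U i))
    (g : Fin (l + 1) → G) : Matrix (Fin (l + 1)) (Fin (l + 1)) ℂ :=
  Matrix.of fun i j => (γ i).character (g j)

/-- The diagonal matrix `Δ(t, u)`. -/
def deltaMatrix (Γ : Subgroup SL(3, ℂ)) {l : ℕ} (g : Fin (l + 1) → Γ) :
    Matrix (Fin (l + 1)) (Fin (l + 1)) RatFun2 :=
  Matrix.diagonal fun j =>
    ratF (starRingEnd ℂ (naturalCharacter Γ (g j))) (naturalCharacter Γ (g j))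

/-- A complex matrix seen as a matrix over `ℂ(t, u)`. -/
def constMatrix {l : ℕ} (M : Matrix (Fin (l + 1)) (Fin (l + 1)) ℂ) :
    Matrix (Fin (l + 1)) (Fin (l + 1)) RatFun2 :=
  M.map (algebraMap ℂ RatFun2)

end

/-!
Let `π_{m,n}` be the simple representation of highest weight `m ϖ₁ + n ϖ₂`. The heart of the matter
is its character at an element of finite order; the rest is the character theory of finite groups.

A highest weight vector `w` has a matrix coefficient `φ (π h w)` equal to the product of the `m`-th
power of the first and the `n`-th power of the second leading principal minor of `h`
(`exists_dual_apply_eq`). Written at `g * h`, this is by Cauchy–Binet the value at the flag of `g`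
of a form `(x · a) ^ m (y · b) ^ n`, where `(x, y)` is the flag of the transpose of `h`. The flag
coordinates `(a, b)` of elements of `SL₃(ℂ)` satisfy `a · b = 0`, and a bihomogeneous polynomial
that vanishes on them is a multiple of the quadric `a · b` (`quadric_dvd_of_eval_flagPoint`). Modulo
the quadric, the forms above span all bihomogeneous polynomials of bidegree `(m, n)`, because no
nonzero multiple of the quadric is harmonic (`eq_zero_of_powerForm`). Thus `π_{m,n}` is the space of
these polynomials modulo the quadric (`exists_bihom_surjective`). With `h_k` the complete
homogeneous symmetric functions, its trace at the diagonal matrix of entries `d` is therefore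
`h_m(d) h_n(d⁻¹) - h_{m-1}(d) h_{n-1}(d⁻¹)` (`trace_diagonal`).

An element of finite order is conjugate to a diagonal matrix whose entries have modulus one
(`exists_conj_diagonal`), and summing the traces gives `(1 - t u)` divided by the two cubics of the
statement (`characterSeries_eq`).

For the finite group, Maschke's theorem and Schur's lemma give complete reducibility
(`IsIrrepList.nonempty_equiv_directSum`) and the equality of the numbers of conjugacy classes and of
irreducible representations (`IsIrrepList.card_conjClasses`). Orthogonality of characters gives the
inverse of the character table (`IsIrrepList.charTable_mul_charTableInv`) and the multiplicities
(`IsIrrepList.repMultiplicity_eq`); applied to the generating functions of the characters it yields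
the matrix formula (`algebraMap_multSeries`). Rationality of the coordinates follows from the
formula.
-/

noncomputable section

/-! ### The highest weight matrix coefficient -/

theorem specialLinear_mul_apply (g h : SL(3, ℂ)) (i j : Fin 3) :
    (g * h).1 i j = g.1 i 0 * h.1 0 j + g.1 i 1 * h.1 1 j + g.1 i 2 * h.1 2 j := by
  rw [Matrix.SpecialLinearGroup.coe_mul, Matrix.mul_apply, Fin.sum_univ_three]

/-- The leading principal `2 × 2` minor. -/
def leadingMinor (h : SL(3, ℂ)) : ℂ := h.1 0 0 * h.1 1 1 - h.1 1 0 * h.1 0 1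

/-- A lower unitriangular matrix. -/
def lowerUnitriangular (a b c : ℂ) : SL(3, ℂ) :=
  ⟨!![1, 0, 0; a, 1, 0; b, c, 1], by simp [Matrix.det_fin_three]⟩

/-- The cocharacter `ε ↦ diag(ε⁻¹, 1, ε)`, which contracts the lower unitriangular matrices
to `1` as `ε → 0`. -/
def contractingTorus (ε : ℂ) (hε : ε ≠ 0) : SL(3, ℂ) :=
  ⟨!![ε⁻¹, 0, 0; 0, 1, 0; 0, 0, ε], by simp [Matrix.det_fin_three, hε]⟩

theorem contractingTorus_mul_lowerUnitriangular (ε : ℂ) (hε : ε ≠ 0) (a b c : ℂ) :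
    contractingTorus ε hε * lowerUnitriangular a b c =
      lowerUnitriangular (ε * a) (ε ^ 2 * b) (ε * c) * contractingTorus ε hε := by
  ext i j
  rw [specialLinear_mul_apply, specialLinear_mul_apply]
  fin_cases i <;> fin_cases j <;> simp [contractingTorus, lowerUnitriangular] <;> field_simp

/-- The LU decomposition on the big cell, which consists of the matrices whose leading principal
minors do not vanish. -/
theorem exists_lowerUnitriangular_mul_upper (h : SL(3, ℂ)) (h0 : h.1 0 0 ≠ 0)
    (h1 : leadingMinor h ≠ 0) :
    ∃ (a b c : ℂ) (t : SL(3, ℂ)), h = lowerUnitriangular a b c * t ∧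
      (∀ i j : Fin 3, j < i → t.1 i j = 0) ∧ t.1 0 0 = h.1 0 0 ∧
      t.1 0 0 * t.1 1 1 = leadingMinor h := by
  have hd := h.2
  rw [Matrix.det_fin_three] at hd
  unfold leadingMinor at h1 ⊢
  set M := h.1 0 0 * h.1 1 1 - h.1 1 0 * h.1 0 1 with hM
  let t : SL(3, ℂ) := ⟨!![h.1 0 0, h.1 0 1, h.1 0 2;
      0, M / h.1 0 0, (h.1 0 0 * h.1 1 2 - h.1 1 0 * h.1 0 2) / h.1 0 0; 0, 0, M⁻¹],
      by simp [Matrix.det_fin_three]; field_simp⟩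
  refine ⟨h.1 1 0 / h.1 0 0, h.1 2 0 / h.1 0 0, (h.1 0 0 * h.1 2 1 - h.1 2 0 * h.1 0 1) / M, t,
    ?_, ?_, ?_, ?_⟩
  · ext i j
    rw [specialLinear_mul_apply]
    fin_cases i <;> fin_cases j <;> simp [t, lowerUnitriangular] <;> field_simp
    · rw [hM]; ring
    · ring
    · ring
    · rw [hM] at *
      linear_combination h.1 0 0 * hd
  · intro i j hij
    fin_cases i <;> fin_cases j <;> simp [t] at hij ⊢
  · simp [t]
  · simp [t]; field_simp

/-- A polynomial curve of upper unitriangular matrices. -/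
def upperCurve (s : ℂ) : SL(3, ℂ) :=
  ⟨!![1, s, s ^ 2; 0, 1, 2 * s; 0, 0, 1], by simp [Matrix.det_fin_three]⟩

/-- The big cell is Zariski dense in `SL₃(ℂ)`. The curve `s ↦ upperCurve s * h` passes through `h`
at `s = 0`, and along it the two leading minors are nonzero polynomials in `s`. -/
theorem eval_eq_zero_of_bigCell (p : MvPolynomial (Fin 3 × Fin 3) ℂ)
    (hp : ∀ h : SL(3, ℂ), h.1 0 0 ≠ 0 → leadingMinor h ≠ 0 →
      MvPolynomial.eval (fun ij => h.1 ij.1 ij.2) p = 0) (h : SL(3, ℂ)) :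
    MvPolynomial.eval (fun ij => h.1 ij.1 ij.2) p = 0 := by
  have hd := h.2
  rw [Matrix.det_fin_three] at hd
  let c : Matrix (Fin 3) (Fin 3) (Polynomial ℂ) :=
    !![1, Polynomial.X, Polynomial.X ^ 2; 0, 1, 2 * Polynomial.X; 0, 0, 1] * h.1.map Polynomial.C
  have hc : ∀ s i j, (c i j).eval s = (upperCurve s * h).1 i j := by
    intro s i j
    rw [specialLinear_mul_apply]
    simp only [c, Matrix.mul_apply, Fin.sum_univ_three, Matrix.map_apply]
    fin_cases i <;> simp [upperCurve]
    ring
  let q : Polynomial ℂ := MvPolynomial.aeval (fun ij : Fin 3 × Fin 3 => c ij.1 ij.2) p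
  have hq : ∀ s, q.eval s =
      MvPolynomial.eval (fun ij => (upperCurve s * h).1 ij.1 ij.2) p := by
    intro s
    have : (Polynomial.evalRingHom s).comp (algebraMap ℂ (Polynomial ℂ)) = RingHom.id ℂ := by
      ext x; simp
    simp only [q, MvPolynomial.aeval_def]
    rw [← Polynomial.coe_evalRingHom, MvPolynomial.hom_eval₂, this]
    simp only [Polynomial.coe_evalRingHom, hc]
    rfl
  let r₁ : Polynomial ℂ := Polynomial.C (h.1 0 0) + Polynomial.C (h.1 1 0) * Polynomial.X +
    Polynomial.C (h.1 2 0) * Polynomial.X ^ 2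
  let r₂ : Polynomial ℂ := Polynomial.C (h.1 0 0 * h.1 1 1 - h.1 1 0 * h.1 0 1) +
    Polynomial.C (2 * (h.1 0 0 * h.1 2 1 - h.1 2 0 * h.1 0 1)) * Polynomial.X +
    Polynomial.C (h.1 1 0 * h.1 2 1 - h.1 2 0 * h.1 1 1) * Polynomial.X ^ 2
  have hr₁ : ∀ s, r₁.eval s = (upperCurve s * h).1 0 0 := by
    intro s; rw [specialLinear_mul_apply]; simp [r₁, upperCurve]; ring
  have hr₂ : ∀ s, r₂.eval s = leadingMinor (upperCurve s * h) := by
    intro s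
    simp only [leadingMinor, specialLinear_mul_apply]
    simp [r₂, upperCurve]; ring
  have hr₁0 : r₁ ≠ 0 := by
    intro h0
    have e0 := congrArg (fun f => Polynomial.coeff f 0) h0
    have e1 := congrArg (fun f => Polynomial.coeff f 1) h0
    have e2 := congrArg (fun f => Polynomial.coeff f 2) h0
    simp [r₁, Polynomial.coeff_X, Polynomial.coeff_C, Polynomial.coeff_X_pow] at e0 e1 e2
    simp [e0, e1, e2] at hd
  have hr₂0 : r₂ ≠ 0 := by
    intro h0
    have e0 := congrArg (fun f => Polynomial.coeff f 0) h0
    have e1 := congrArg (fun f => Polynomial.coeff f 1) h0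
    have e2 := congrArg (fun f => Polynomial.coeff f 2) h0
    simp [r₂, Polynomial.coeff_X, Polynomial.coeff_C, -map_sub, -map_mul] at e0 e1 e2
    refine one_ne_zero (α := ℂ) ?_
    linear_combination -hd + h.1 0 2 * e2 - h.1 1 2 * e1 + h.1 2 2 * e0
  have hprod : q * (r₁ * r₂) = 0 := by
    refine Polynomial.funext fun s => ?_
    rw [Polynomial.eval_mul, Polynomial.eval_mul, hr₁, hr₂, hq, Polynomial.eval_zero]
    by_cases h1 : (upperCurve s * h).1 0 0 = 0
    · simp [h1]
    by_cases h2 : leadingMinor (upperCurve s * h) = 0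
    · simp [h2]
    rw [hp _ h1 h2, zero_mul]
  have hq0 : q = 0 := (mul_eq_zero.1 hprod).resolve_right (mul_ne_zero hr₁0 hr₂0)
  have := hq 0
  rw [hq0, Polynomial.eval_zero] at this
  have h1 : upperCurve 0 = 1 := by
    ext i j; fin_cases i <;> fin_cases j <;> simp [upperCurve]
  rw [h1, one_mul] at this
  exact this.symm

open Filter Topology in
/-- A highest weight vector has a matrix coefficient that is a product of powers of leading minors.
On the orbit of the big cell, the functional is the limit of
`ε ^ (m + n) • φ₀ ∘ π (diag(ε⁻¹, 1, ε))` as `ε → 0`, for any `φ₀` with `φ₀ w = 1`: the torus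
contracts the lower unitriangular factor of `h` to `1`. -/
theorem exists_dual_apply_eq {W : Type*} [AddCommGroup W] [Module ℂ W]
    {π : Representation ℂ SL(3, ℂ) W} (hrat : IsRationalRep π) {m n : ℕ} {w : W}
    (hw : IsHighestWeightVector π m n w) :
    ∃ φ : Module.Dual ℂ W, ∀ h : SL(3, ℂ), φ (π h w) = h.1 0 0 ^ m * leadingMinor h ^ n := by
  obtain ⟨φ₀, hφ₀⟩ : ∃ φ₀ : Module.Dual ℂ W, φ₀ w = 1 := by
    obtain ⟨f, hf⟩ := Module.Projective.exists_dual_ne_zero ℂ hw.1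
    exact ⟨(f w)⁻¹ • f, by simp [hf]⟩
  let B := {h : SL(3, ℂ) // h.1 0 0 ≠ 0 ∧ leadingMinor h ≠ 0}
  let F : (B →₀ ℂ) →ₗ[ℂ] W := Finsupp.linearCombination ℂ fun h : B => π h.1 w
  let Δ : (B →₀ ℂ) →ₗ[ℂ] ℂ :=
    Finsupp.linearCombination ℂ fun h : B => h.1.1 0 0 ^ m * leadingMinor h.1 ^ n
  let c : ℂ → W →ₗ[ℂ] ℂ := fun ε =>
    if hε : ε ≠ 0 then ε ^ (m + n) • (φ₀ ∘ₗ π (contractingTorus ε hε)) else 0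
  have hlim1 : ∀ h : B, Tendsto (fun ε => c ε (π h.1 w)) (𝓝[≠] 0)
      (𝓝 (h.1.1 0 0 ^ m * leadingMinor h.1 ^ n)) := by
    rintro ⟨h, h0, h1⟩
    obtain ⟨x, y, z, t, hh, ht, ht0, ht1⟩ := exists_lowerUnitriangular_mul_upper h h0 h1
    obtain ⟨p, hp⟩ := hrat w φ₀
    have hc : ∀ ε ∈ ({0}ᶜ : Set ℂ), (h.1 0 0 ^ m * leadingMinor h ^ n) *
        φ₀ (π (lowerUnitriangular (ε * x) (ε ^ 2 * y) (ε * z)) w) = c ε (π h w) := by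
      intro ε hε
      have hε : ε ≠ 0 := hε
      have hT := hw.2 (contractingTorus ε hε) (by
        intro i j hij
        fin_cases i <;> fin_cases j <;> simp [contractingTorus] at hij ⊢)
      simp only [c, hε, ne_eq, not_false_eq_true, dif_pos, LinearMap.smul_apply,
        LinearMap.comp_apply, smul_eq_mul]
      rw [hh, map_mul, Module.End.mul_apply, hw.2 t ht, ht1, ht0, ← hh, map_smul, map_smul,
        map_smul, smul_eq_mul, ← Module.End.mul_apply, ← map_mul,
        contractingTorus_mul_lowerUnitriangular, map_mul, Module.End.mul_apply, hT, map_smul,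
        map_smul, smul_eq_mul]
      have : ε ^ (m + n) * ((contractingTorus ε hε).1 0 0 ^ m *
          ((contractingTorus ε hε).1 0 0 * (contractingTorus ε hε).1 1 1) ^ n) = 1 := by
        simp [contractingTorus, pow_add]
        field_simp
      linear_combination (-(h.1 0 0 ^ m * leadingMinor h ^ n *
        φ₀ (π (lowerUnitriangular (ε * x) (ε ^ 2 * y) (ε * z)) w))) * this
    refine Tendsto.congr' (eventually_nhdsWithin_of_forall hc) ?_
    have hcont : Continuous fun ε : ℂ => (h.1 0 0 ^ m * leadingMinor h ^ n) *
        φ₀ (π (lowerUnitriangular (ε * x) (ε ^ 2 * y) (ε * z)) w) := by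
      refine continuous_const.mul ?_
      simp only [hp]
      refine (MvPolynomial.continuous_eval p).comp (continuous_pi ?_)
      rintro ⟨i, j⟩
      fin_cases i <;> fin_cases j <;> simp [lowerUnitriangular] <;> fun_prop
    have h0 := (hcont.tendsto 0).mono_left (nhdsWithin_le_nhds (s := ({0}ᶜ : Set ℂ)))
    have e1 : lowerUnitriangular (0 * x) (0 ^ 2 * y) (0 * z) = 1 := by
      ext i j; fin_cases i <;> fin_cases j <;> simp [lowerUnitriangular]
    simpa only [e1, map_one, Module.End.one_apply, hφ₀, mul_one] using h0
  have hlim : ∀ v : B →₀ ℂ, Tendsto (fun ε => c ε (F v)) (𝓝[≠] 0) (𝓝 (Δ v)) := by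
    intro v
    simp only [F, Δ, Finsupp.linearCombination_apply, Finsupp.sum, map_sum, map_smul]
    exact tendsto_finsetSum _ fun h _ => (hlim1 h).const_smul (v h)
  -- the limit respects all linear relations in the orbit, so it comes from a functional on `W`
  have hker : Δ ∈ LinearMap.range F.dualMap := by
    rw [LinearMap.range_dualMap_eq_dualAnnihilator_ker, Submodule.mem_dualAnnihilator]
    intro v hv
    have := hlim v
    rw [LinearMap.mem_ker.1 hv] at this
    simp only [map_zero] at this
    exact tendsto_nhds_unique this tendsto_const_nhds
  obtain ⟨φ, hφ⟩ := hker
  refine ⟨φ, fun h => ?_⟩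
  obtain ⟨p, hp⟩ := hrat w φ
  let q : MvPolynomial (Fin 3 × Fin 3) ℂ := p - MvPolynomial.X (0, 0) ^ m *
    (MvPolynomial.X (0, 0) * MvPolynomial.X (1, 1) -
      MvPolynomial.X (1, 0) * MvPolynomial.X (0, 1)) ^ n
  have := eval_eq_zero_of_bigCell q (by
    intro h h0 h1
    have := LinearMap.congr_fun hφ (Finsupp.single ⟨h, h0, h1⟩ 1)
    simp [F, Δ] at this
    simp [q, ← hp, this, leadingMinor]) h
  simp only [q, map_sub, ← hp, sub_eq_zero] at this
  rw [this]
  simp [leadingMinor]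

/-! ### The invariant quadric, flags and harmonic polynomials -/

section

open MvPolynomial

/-- The bidegrees of the variables of `ℂ[a₀, a₁, a₂, b₀, b₁, b₂]`. -/
def bidegree : Fin 3 ⊕ Fin 3 → ℕ × ℕ := Sum.elim (fun _ => (1, 0)) (fun _ => (0, 1))

/-- The space of bihomogeneous polynomials of bidegree `(m, n)` in `a` and `b`. -/
abbrev Bihom (m n : ℕ) : Submodule ℂ (MvPolynomial (Fin 3 ⊕ Fin 3) ℂ) :=
  weightedHomogeneousSubmodule ℂ bidegree (m, n)

/-- The invariant quadric `a₀ b₀ + a₁ b₁ + a₂ b₂`. -/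
def quadric : MvPolynomial (Fin 3 ⊕ Fin 3) ℂ := ∑ i : Fin 3, X (Sum.inl i) * X (Sum.inr i)

theorem quadric_mem : quadric ∈ Bihom 1 1 := by
  refine Submodule.sum_mem _ fun i _ => ?_
  exact (isWeightedHomogeneous_X ℂ bidegree (Sum.inl i)).mul
    (isWeightedHomogeneous_X ℂ bidegree (Sum.inr i))

theorem irreducible_quadric : Irreducible quadric := by
  have h := irreducible_sumSMulXSMulY (R := ℂ)
    (Finsupp.equivFunOnFinite.symm (fun _ : Fin 3 => (1 : ℂ)))
    (by
      have : (Finsupp.equivFunOnFinite.symm (fun _ : Fin 3 => (1 : ℂ))).support =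
          Finset.univ := by ext; simp
      rw [this]; exact ⟨0, by simp, 1, by simp, by decide⟩)
    (fun r hr => isUnit_of_dvd_one (by simpa using hr 0))
  convert h using 1
  simp [sumSMulXSMulY, Finsupp.linearCombination_apply, quadric, Finsupp.sum_fintype]

theorem quadric_ne_zero : quadric ≠ 0 := irreducible_quadric.ne_zero

/-- The Nullstellensatz for the irreducible quadric. -/
theorem quadric_dvd_of_eval_eq_zero (p : MvPolynomial (Fin 3 ⊕ Fin 3) ℂ)
    (hp : ∀ x : Fin 3 ⊕ Fin 3 → ℂ, eval x quadric = 0 → eval x p = 0) : quadric ∣ p := by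
  have hprime : (Ideal.span {quadric}).IsPrime :=
    (Ideal.span_singleton_prime quadric_ne_zero).2 irreducible_quadric.prime
  rw [← Ideal.mem_span_singleton, ← IsPrime.vanishingIdeal_zeroLocus (K := ℂ)
    (Ideal.span {quadric})]
  intro x hx
  have := hx quadric (Ideal.mem_span_singleton_self _)
  exact hp x this

/-- The homogeneous coordinates `(a, b)` of a flag: the first row of `g`, and the cross product
of its first two rows. They satisfy `a · b = 0`. -/
def flagPoint (g : SL(3, ℂ)) : Fin 3 ⊕ Fin 3 → ℂ :=
  Sum.elim (g.1 0) ![g.1 0 1 * g.1 1 2 - g.1 0 2 * g.1 1 1, g.1 0 2 * g.1 1 0 - g.1 0 0 * g.1 1 2,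
    g.1 0 0 * g.1 1 1 - g.1 0 1 * g.1 1 0]

theorem eval_quadric (x : Fin 3 ⊕ Fin 3 → ℂ) :
    eval x quadric = x (.inl 0) * x (.inr 0) + x (.inl 1) * x (.inr 1) +
      x (.inl 2) * x (.inr 2) := by
  simp [quadric, Fin.sum_univ_three]

theorem eval_flagPoint_quadric (g : SL(3, ℂ)) : eval (flagPoint g) quadric = 0 := by
  rw [eval_quadric]
  simp [flagPoint]; ring

theorem sum_mul_conj_ne_zero {a : Fin 3 → ℂ} (ha : a ≠ 0) :
    a 0 * starRingEnd ℂ (a 0) + a 1 * starRingEnd ℂ (a 1) + a 2 * starRingEnd ℂ (a 2) ≠ 0 := by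
  intro h
  simp only [Complex.mul_conj] at h
  norm_cast at h
  have h0 := Complex.normSq_nonneg (a 0)
  have h1 := Complex.normSq_nonneg (a 1)
  have h2 := Complex.normSq_nonneg (a 2)
  apply ha
  ext i
  fin_cases i <;> simp only [Fin.zero_eta, Fin.mk_one, Fin.reduceFinMk, Pi.zero_apply] <;>
    rw [← Complex.normSq_eq_zero] <;> linarith

/-- Every flag comes from `SL₃(ℂ)`. The second row of `g` is `(b × ā) / |a|²` and the third one
is `b̄ / |b|²`. -/
theorem exists_flagPoint_eq (x : Fin 3 ⊕ Fin 3 → ℂ) (hx : eval x quadric = 0)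
    (ha : (fun i => x (.inl i)) ≠ 0) (hb : (fun i => x (.inr i)) ≠ 0) :
    ∃ g, flagPoint g = x := by
  rw [eval_quadric] at hx
  have hA := sum_mul_conj_ne_zero ha
  have hB := sum_mul_conj_ne_zero hb
  set A := x (.inl 0) * starRingEnd ℂ (x (.inl 0)) + x (.inl 1) * starRingEnd ℂ (x (.inl 1)) +
    x (.inl 2) * starRingEnd ℂ (x (.inl 2)) with hAdef
  set B := x (.inr 0) * starRingEnd ℂ (x (.inr 0)) + x (.inr 1) * starRingEnd ℂ (x (.inr 1)) +
    x (.inr 2) * starRingEnd ℂ (x (.inr 2)) with hBdef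
  let v : Fin 3 → ℂ := ![
    (x (.inr 1) * starRingEnd ℂ (x (.inl 2)) - x (.inr 2) * starRingEnd ℂ (x (.inl 1))) / A,
    (x (.inr 2) * starRingEnd ℂ (x (.inl 0)) - x (.inr 0) * starRingEnd ℂ (x (.inl 2))) / A,
    (x (.inr 0) * starRingEnd ℂ (x (.inl 1)) - x (.inr 1) * starRingEnd ℂ (x (.inl 0))) / A]
  have e0 : x (.inl 1) * v 2 - x (.inl 2) * v 1 = x (.inr 0) := by
    simp only [v, Matrix.cons_val]
    field_simp
    linear_combination (-x (.inr 0)) * hAdef - starRingEnd ℂ (x (.inl 0)) * hx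
  have e1 : x (.inl 2) * v 0 - x (.inl 0) * v 2 = x (.inr 1) := by
    simp only [v, Matrix.cons_val]
    field_simp
    linear_combination (-x (.inr 1)) * hAdef - starRingEnd ℂ (x (.inl 1)) * hx
  have e2 : x (.inl 0) * v 1 - x (.inl 1) * v 0 = x (.inr 2) := by
    simp only [v, Matrix.cons_val]
    field_simp
    linear_combination (-x (.inr 2)) * hAdef - starRingEnd ℂ (x (.inl 2)) * hx
  let M : Matrix (Fin 3) (Fin 3) ℂ := !![x (.inl 0), x (.inl 1), x (.inl 2); v 0, v 1, v 2;
    starRingEnd ℂ (x (.inr 0)) / B, starRingEnd ℂ (x (.inr 1)) / B, starRingEnd ℂ (x (.inr 2)) / B]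
  have hM : M.det = 1 := by
    rw [Matrix.det_fin_three]
    simp only [M, Matrix.of_apply, Matrix.cons_val]
    field_simp
    linear_combination starRingEnd ℂ (x (.inr 0)) * e0 + starRingEnd ℂ (x (.inr 1)) * e1 +
      starRingEnd ℂ (x (.inr 2)) * e2 - hBdef
  refine ⟨⟨M, hM⟩, ?_⟩
  funext s
  rcases s with i | i
  · fin_cases i <;> simp [flagPoint, M]
  · fin_cases i <;> simp [flagPoint, M, e0, e1, e2]

theorem eval_smul_of_mem_bihom {m n : ℕ} {p : MvPolynomial (Fin 3 ⊕ Fin 3) ℂ} (hp : p ∈ Bihom m n)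
    (s r : ℂ) (x : Fin 3 ⊕ Fin 3 → ℂ) :
    eval (Sum.elim (fun i => s * x (.inl i)) (fun i => r * x (.inr i))) p =
      s ^ m * r ^ n * eval x p := by
  rw [eval_eq', eval_eq', Finset.mul_sum]
  refine Finset.sum_congr rfl fun γ hγ => ?_
  have h := hp (mem_support_iff.1 hγ)
  rw [Finsupp.weight_apply, Finsupp.sum_fintype _ _ (by simp)] at h
  simp only [Fintype.sum_sum_type, bidegree, Sum.elim_inl, Sum.elim_inr, Prod.smul_mk,
    smul_eq_mul, mul_one, mul_zero, Prod.ext_iff, Prod.fst_add, Prod.snd_add,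
    Prod.fst_sum, Prod.snd_sum, Finset.sum_const_zero, add_zero, zero_add] at h
  simp only [Fintype.prod_sum_type, Sum.elim_inl, Sum.elim_inr, mul_pow, Finset.prod_mul_distrib,
    Finset.prod_pow_eq_pow_sum, h.1, h.2]
  ring

theorem exists_orthogonal_ne_zero (b : Fin 3 → ℂ) :
    ∃ a : Fin 3 → ℂ, a ≠ 0 ∧ a 0 * b 0 + a 1 * b 1 + a 2 * b 2 = 0 := by
  by_cases h : b 0 = 0 ∧ b 1 = 0
  · exact ⟨![1, 0, 0], fun h0 => one_ne_zero (congrFun h0 0), by simp [h.1]⟩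
  · refine ⟨![b 1, - b 0, 0], fun h0 => h ?_, by simp; ring⟩
    exact ⟨by simpa using congrFun h0 1, by simpa using congrFun h0 0⟩

/-- A bihomogeneous polynomial that vanishes on the flags is divisible by the quadric. The points
of the quadric with `a = 0` or `b = 0` arise from flags by scaling `a` or `b` by zero. -/
theorem quadric_dvd_of_eval_flagPoint {m n : ℕ} {p : MvPolynomial (Fin 3 ⊕ Fin 3) ℂ}
    (hp : p ∈ Bihom m n) (h : ∀ g, eval (flagPoint g) p = 0) : quadric ∣ p := by
  have key : ∀ x : Fin 3 ⊕ Fin 3 → ℂ, eval x quadric = 0 → (fun i => x (.inl i)) ≠ 0 →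
      eval x p = 0 := by
    intro x hx ha
    by_cases hb : (fun i => x (.inr i)) = 0
    · obtain ⟨b, hb0, hb1⟩ := exists_orthogonal_ne_zero (fun i => x (.inl i))
      have h1 : eval (Sum.elim (fun i => x (.inl i)) b) p = 0 := by
        obtain ⟨g, hg⟩ := exists_flagPoint_eq (Sum.elim (fun i => x (.inl i)) b)
          (by rw [eval_quadric]; simp only [Sum.elim_inl, Sum.elim_inr]; linear_combination hb1)
          ha hb0
        rw [← hg, h]
      have h2 := eval_smul_of_mem_bihom hp 1 0 (Sum.elim (fun i => x (.inl i)) b)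
      rw [h1, mul_zero] at h2
      rw [← h2]
      congr 2
      funext s
      rcases s with i | i
      · simp
      · simpa using congrFun hb i
    · obtain ⟨g, hg⟩ := exists_flagPoint_eq x hx ha hb
      rw [← hg, h]
  refine quadric_dvd_of_eval_eq_zero p fun x hx => ?_
  by_cases ha : (fun i => x (.inl i)) = 0
  · obtain ⟨a, ha0, ha1⟩ := exists_orthogonal_ne_zero (fun i => x (.inr i))
    have h1 := key (Sum.elim a (fun i => x (.inr i)))
      (by rw [eval_quadric]; simpa only [Sum.elim_inl, Sum.elim_inr]) ha0
    have h2 := eval_smul_of_mem_bihom hp 0 1 (Sum.elim a (fun i => x (.inr i)))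
    rw [h1, mul_zero] at h2
    rw [← h2]
    congr 2
    funext s
    rcases s with i | i
    · simpa using congrFun ha i
    · simp
  · exact key x hx ha

section
attribute [local instance] MvPolynomial.weightedGradedAlgebra

/-- The quotient of a bihomogeneous polynomial by the quadric is bihomogeneous. -/
theorem exists_bihom_eq_quadric_mul {m n : ℕ} {p : MvPolynomial (Fin 3 ⊕ Fin 3) ℂ}
    (hp : p ∈ Bihom (m + 1) (n + 1)) (h : quadric ∣ p) : ∃ q ∈ Bihom m n, p = quadric * q := by
  obtain ⟨q, rfl⟩ := h
  have h1 := DirectSum.coe_decompose_mul_add_of_left_mem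
    (weightedHomogeneousSubmodule ℂ bidegree) (j := (m, n)) (b := q) quadric_mem
  have h2 : ((1, 1) + (m, n) : ℕ × ℕ) = (m + 1, n + 1) := by ext <;> simp [add_comm]
  rw [h2, DirectSum.decompose_of_mem_same (weightedHomogeneousSubmodule ℂ bidegree) hp] at h1
  exact ⟨_, SetLike.coe_mem _, h1⟩

theorem eq_zero_of_quadric_dvd {m n : ℕ} (hmn : m = 0 ∨ n = 0)
    {p : MvPolynomial (Fin 3 ⊕ Fin 3) ℂ} (hp : p ∈ Bihom m n) (h : quadric ∣ p) : p = 0 := by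
  obtain ⟨q, rfl⟩ := h
  have h1 := DirectSum.coe_decompose_mul_of_left_mem_of_not_le
    (weightedHomogeneousSubmodule ℂ bidegree) (n := (m, n)) (b := q) quadric_mem
    (by rw [Prod.le_def]; simp; omega)
  rwa [DirectSum.decompose_of_mem_same (weightedHomogeneousSubmodule ℂ bidegree) hp] at h1
end

/-- The Laplacian dual to the quadric. -/
def laplacian : MvPolynomial (Fin 3 ⊕ Fin 3) ℂ →ₗ[ℂ] MvPolynomial (Fin 3 ⊕ Fin 3) ℂ :=
  ∑ i : Fin 3, (pderiv (Sum.inl i)).toLinearMap ∘ₗ (pderiv (Sum.inr i)).toLinearMap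

theorem laplacian_apply (p : MvPolynomial (Fin 3 ⊕ Fin 3) ℂ) :
    laplacian p = ∑ i : Fin 3, pderiv (Sum.inl i) (pderiv (Sum.inr i) p) := by
  simp [laplacian]

theorem laplacian_mem {m n : ℕ} {p : MvPolynomial (Fin 3 ⊕ Fin 3) ℂ}
    (hp : p ∈ Bihom (m + 1) (n + 1)) : laplacian p ∈ Bihom m n := by
  rw [laplacian_apply]
  refine Submodule.sum_mem _ fun i _ => ?_
  have h1 : (pderiv (Sum.inr i) p).IsWeightedHomogeneous bidegree (m + 1, n) :=
    IsWeightedHomogeneous.pderiv hp (by simp [bidegree])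
  exact IsWeightedHomogeneous.pderiv h1 (by simp [bidegree])

theorem laplacian_eq_zero {m n : ℕ} (hmn : m = 0 ∨ n = 0)
    {p : MvPolynomial (Fin 3 ⊕ Fin 3) ℂ} (hp : p ∈ Bihom m n) : laplacian p = 0 := by
  ext γ
  rw [laplacian_apply, coeff_sum, coeff_zero]
  refine Finset.sum_eq_zero fun i _ => ?_
  rw [coeff_pderiv, coeff_pderiv]
  by_contra hne
  have h := hp (left_ne_zero_of_mul (left_ne_zero_of_mul hne))
  simp only [map_add, Finsupp.weight_single, one_smul, bidegree, Prod.ext_iff,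
    Prod.fst_add, Prod.snd_add, Sum.elim_inl, Sum.elim_inr] at h
  omega

theorem euler_left {m n : ℕ} {p : MvPolynomial (Fin 3 ⊕ Fin 3) ℂ} (hp : p ∈ Bihom m n) :
    ∑ i : Fin 3, X (.inl i) * pderiv (.inl i) p = (m : MvPolynomial (Fin 3 ⊕ Fin 3) ℂ) * p := by
  have h : p.IsWeightedHomogeneous (Sum.elim (fun _ => 1) (fun _ => 0) : Fin 3 ⊕ Fin 3 → ℕ) m := by
    intro γ hγ
    have h := hp hγ
    rw [Finsupp.weight_apply, Finsupp.sum_fintype _ _ (by simp)] at h ⊢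
    simpa [bidegree, Prod.ext_iff, Prod.fst_sum] using (Prod.ext_iff.1 h).1
  simpa using h.sum_weight_X_mul_pderiv

theorem euler_right {m n : ℕ} {p : MvPolynomial (Fin 3 ⊕ Fin 3) ℂ} (hp : p ∈ Bihom m n) :
    ∑ i : Fin 3, X (.inr i) * pderiv (.inr i) p = (n : MvPolynomial (Fin 3 ⊕ Fin 3) ℂ) * p := by
  have h : p.IsWeightedHomogeneous (Sum.elim (fun _ => 0) (fun _ => 1) : Fin 3 ⊕ Fin 3 → ℕ) n := by
    intro γ hγ
    have h := hp hγ
    rw [Finsupp.weight_apply, Finsupp.sum_fintype _ _ (by simp)] at h ⊢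
    simpa [bidegree, Prod.ext_iff, Prod.snd_sum] using (Prod.ext_iff.1 h).2
  simpa using h.sum_weight_X_mul_pderiv

/-- The commutation relation of the `𝔰𝔩₂`-triple formed by the Laplacian, the quadric and the
degree operator. -/
theorem laplacian_quadric_mul {m n : ℕ} {q : MvPolynomial (Fin 3 ⊕ Fin 3) ℂ} (hq : q ∈ Bihom m n) :
    laplacian (quadric * q) = quadric * laplacian q + (m + n + 3 : ℂ) • q := by
  have hr : ∀ i : Fin 3, pderiv (.inr i) quadric = X (.inl i) := by
    intro i
    simp [quadric, pderiv_X, Pi.single_apply, Fin.sum_univ_three]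
    fin_cases i <;> simp
  have hl : ∀ i : Fin 3, pderiv (.inl i) quadric = X (.inr i) := by
    intro i
    simp [quadric, pderiv_X, Pi.single_apply, Fin.sum_univ_three]
    fin_cases i <;> simp
  have key : ∀ i : Fin 3, pderiv (Sum.inl i) (pderiv (Sum.inr i) (quadric * q)) =
      quadric * pderiv (Sum.inl i) (pderiv (Sum.inr i) q) +
        X (.inl i) * pderiv (.inl i) q + X (.inr i) * pderiv (.inr i) q + q := by
    intro i
    rw [pderiv_mul, map_add, pderiv_mul, pderiv_mul, hr, hl, pderiv_X_self]
    ring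
  rw [laplacian_apply, laplacian_apply, Finset.sum_congr rfl fun i _ => key i,
    Finset.sum_add_distrib, Finset.sum_add_distrib, Finset.sum_add_distrib, euler_left hq,
    euler_right hq, Finset.mul_sum]
  have h3 : (C 3 : MvPolynomial (Fin 3 ⊕ Fin 3) ℂ) = 3 := map_ofNat C 3
  simp only [Finset.sum_const, Finset.card_univ, Fintype.card_fin, smul_eq_C_mul]
  simp [h3]
  ring

theorem quadric_pow_mul_mem {m n : ℕ} {q : MvPolynomial (Fin 3 ⊕ Fin 3) ℂ} (hq : q ∈ Bihom m n)
    (k : ℕ) : quadric ^ k * q ∈ Bihom (k + m) (k + n) := by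
  have h := (IsWeightedHomogeneous.pow quadric_mem k).mul hq
  simpa using h

theorem laplacian_quadric_pow_mul {m n : ℕ} {q : MvPolynomial (Fin 3 ⊕ Fin 3) ℂ}
    (hq : q ∈ Bihom m n) (k : ℕ) :
    laplacian (quadric ^ (k + 1) * q) = quadric ^ (k + 1) * laplacian q +
      ((k + 1) * (m + n + 3 + k) : ℂ) • (quadric ^ k * q) := by
  induction k with
  | zero => simpa using laplacian_quadric_mul hq
  | succ k ih =>
    rw [pow_succ' quadric (k + 1), mul_assoc,
      laplacian_quadric_mul (quadric_pow_mul_mem hq (k + 1)), ih]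
    simp only [smul_eq_C_mul]
    simp
    ring

/-- No nonzero multiple of the quadric is harmonic. If `Q ^ (k + 1) * q` is harmonic, then `q` is a
multiple of `Q * Δ q` and `Q ^ (k + 2) * Δ q` is harmonic too, which allows an induction on the
bidegree of `q`. -/
theorem eq_zero_of_laplacian_quadric_pow_mul {m n : ℕ} {q : MvPolynomial (Fin 3 ⊕ Fin 3) ℂ}
    (hq : q ∈ Bihom m n) (k : ℕ) (h : laplacian (quadric ^ (k + 1) * q) = 0) : q = 0 := by
  induction m generalizing n q k with
  | zero =>
    rw [laplacian_quadric_pow_mul hq, laplacian_eq_zero (.inl rfl) hq, mul_zero, zero_add] at h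
    have hc : ((k + 1) * ((0 : ℕ) + n + 3 + k) : ℂ) ≠ 0 := by norm_cast; positivity
    exact (mul_eq_zero.1 ((smul_eq_zero.1 h).resolve_left hc)).resolve_left
      (pow_ne_zero _ quadric_ne_zero)
  | succ m ih =>
    have hc : ((k + 1) * ((m + 1 : ℕ) + n + 3 + k) : ℂ) ≠ 0 := by norm_cast; positivity
    have h0 := h
    rw [laplacian_quadric_pow_mul hq] at h
    rcases n with _ | n
    · rw [laplacian_eq_zero (.inr rfl) hq, mul_zero, zero_add] at h
      exact (mul_eq_zero.1 ((smul_eq_zero.1 h).resolve_left hc)).resolve_left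
        (pow_ne_zero _ quadric_ne_zero)
    set c : ℂ := ((k + 1) * ((m + 1 : ℕ) + (n + 1 : ℕ) + 3 + k) : ℂ) with hcdef
    have h1 : q = (-c⁻¹) • (quadric * laplacian q) := by
      have h2 : quadric ^ k * (quadric * laplacian q + c • q) = 0 := by
        rw [← h, smul_eq_C_mul, smul_eq_C_mul]; ring
      have h3 := (mul_eq_zero.1 h2).resolve_left (pow_ne_zero _ quadric_ne_zero)
      rw [eq_neg_of_add_eq_zero_left h3, neg_smul, smul_neg, neg_neg, smul_smul,
        inv_mul_cancel₀ hc, one_smul]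
    have h4 : laplacian q = 0 := by
      refine ih (laplacian_mem hq) (k + 1) ?_
      have h5 : quadric ^ (k + 1 + 1) * laplacian q = (-c) • (quadric ^ (k + 1) * q) := by
        conv_rhs => rw [h1, mul_smul_comm, smul_smul, neg_mul_neg, mul_inv_cancel₀ hc, one_smul]
        ring
      rw [h5, map_smul, h0, smul_zero]
    rw [h1, h4, mul_zero, smul_zero]

end

/-! ### Monomials and spanning by powers of linear forms -/

section

open MvPolynomial

/-- The exponent of the monomial `a ^ α b ^ β`. -/
def biexponent (α : (Fin 3 → ℕ) × (Fin 3 → ℕ)) : Fin 3 ⊕ Fin 3 →₀ ℕ :=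
  Finsupp.equivFunOnFinite.symm (Sum.elim α.1 α.2)

theorem biexponent_injective : Function.Injective biexponent := by
  intro α β h
  have h := Finsupp.equivFunOnFinite.symm.injective h
  ext i
  · simpa using congrFun h (.inl i)
  · simpa using congrFun h (.inr i)

/-- The exponents of the monomials of bidegree `(m, n)`. -/
def biexponents (m n : ℕ) : Finset (Fin 3 ⊕ Fin 3 →₀ ℕ) :=
  (Finset.piAntidiag Finset.univ m ×ˢ Finset.piAntidiag Finset.univ n).map
    ⟨biexponent, biexponent_injective⟩

theorem sum_biexponents {R : Type*} [AddCommMonoid R] (m n : ℕ)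
    (f : (Fin 3 ⊕ Fin 3 →₀ ℕ) → R) :
    ∑ γ ∈ biexponents m n, f γ = ∑ k ∈ Finset.piAntidiag (Finset.univ : Finset (Fin 3)) m,
      ∑ l ∈ Finset.piAntidiag (Finset.univ : Finset (Fin 3)) n, f (biexponent (k, l)) := by
  rw [biexponents, Finset.sum_map, Finset.sum_product]
  rfl

theorem mem_biexponents {m n : ℕ} {γ : Fin 3 ⊕ Fin 3 →₀ ℕ} :
    γ ∈ biexponents m n ↔ Finsupp.weight bidegree γ = (m, n) := by
  rw [Finsupp.weight_apply, Finsupp.sum_fintype _ _ (by simp)]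
  simp only [Fintype.sum_sum_type, bidegree, Sum.elim_inl, Sum.elim_inr, Prod.smul_mk,
    smul_eq_mul, mul_one, mul_zero, Prod.ext_iff, Prod.fst_add, Prod.snd_add, Prod.fst_sum,
    Prod.snd_sum, Finset.sum_const_zero, add_zero, zero_add]
  simp only [biexponents, Finset.mem_map, Finset.mem_product, Finset.mem_piAntidiag,
    Function.Embedding.coeFn_mk, Finset.mem_univ, implies_true, and_true]
  constructor
  · rintro ⟨α, h, rfl⟩
    simpa [biexponent] using h
  · intro h
    refine ⟨(fun i => γ (.inl i), fun i => γ (.inr i)), h, ?_⟩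
    ext s
    rcases s with i | i <;> simp [biexponent]

theorem monomial_mem_bihom {m n : ℕ} {γ : Fin 3 ⊕ Fin 3 →₀ ℕ} (hγ : γ ∈ biexponents m n) (c : ℂ) :
    monomial γ c ∈ Bihom m n :=
  isWeightedHomogeneous_monomial _ _ _ (mem_biexponents.1 hγ)

theorem sum_monomial_of_mem_bihom {m n : ℕ} {p : MvPolynomial (Fin 3 ⊕ Fin 3) ℂ}
    (hp : p ∈ Bihom m n) : ∑ γ ∈ biexponents m n, monomial γ (coeff γ p) = p := by
  ext δ
  rw [coeff_sum]
  simp only [coeff_monomial, Finset.sum_ite_eq']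
  split_ifs with h
  · rfl
  · by_contra hne
    exact h (mem_biexponents.2 (hp (Ne.symm hne)))

/-- The monomial basis of the space of bihomogeneous polynomials. -/
def bihomBasis (m n : ℕ) : Module.Basis (biexponents m n) ℂ (Bihom m n) :=
  Module.Basis.ofEquivFun
    { toFun := fun p γ => coeff γ.1 p.1
      map_add' := fun p q => by ext; simp
      map_smul' := fun c p => by ext; simp
      invFun := fun c => ⟨∑ γ, monomial γ.1 (c γ),
        Submodule.sum_mem _ fun γ _ => monomial_mem_bihom γ.2 _⟩
      left_inv := fun p => Subtype.ext <| by
        simp only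
        rw [Finset.sum_coe_sort (biexponents m n) fun γ => monomial γ (coeff γ p.1)]
        exact sum_monomial_of_mem_bihom p.2
      right_inv := fun c => by
        ext γ
        simp only [coeff_sum, coeff_monomial]
        rw [Finset.sum_eq_single γ]
        · simp
        · intro δ _ hδ
          rw [if_neg fun h => hδ (Subtype.ext h)]
        · simp }

theorem coe_bihomBasis {m n : ℕ} (γ : biexponents m n) :
    (bihomBasis m n γ : MvPolynomial (Fin 3 ⊕ Fin 3) ℂ) = monomial γ.1 1 := by
  simp only [bihomBasis, Module.Basis.coe_ofEquivFun, LinearEquiv.coe_symm_mk]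
  rw [Finset.sum_eq_single γ]
  · simp
  · intro δ _ hδ
    simp [hδ]
  · simp

instance (m n : ℕ) : FiniteDimensional ℂ (Bihom m n) := Module.Finite.of_basis (bihomBasis m n)

/-- The bihomogeneous polynomial `(x · a) ^ m (y · b) ^ n` in `a` and `b`, at the point
`(x, y)`. -/
def powerForm (m n : ℕ) (x : Fin 3 ⊕ Fin 3 → ℂ) : MvPolynomial (Fin 3 ⊕ Fin 3) ℂ :=
  (∑ i : Fin 3, C (x (.inl i)) * X (.inl i)) ^ m * (∑ i : Fin 3, C (x (.inr i)) * X (.inr i)) ^ n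

theorem powerForm_mem (m n : ℕ) (x : Fin 3 ⊕ Fin 3 → ℂ) : powerForm m n x ∈ Bihom m n := by
  have h1 : (∑ i : Fin 3, C (x (.inl i)) * X (.inl i) :
      MvPolynomial (Fin 3 ⊕ Fin 3) ℂ).IsWeightedHomogeneous bidegree (1, 0) :=
    Submodule.sum_mem (Bihom 1 0) fun i _ =>
      IsWeightedHomogeneous.C_mul (isWeightedHomogeneous_X ℂ bidegree (.inl i)) _
  have h2 : (∑ i : Fin 3, C (x (.inr i)) * X (.inr i) :
      MvPolynomial (Fin 3 ⊕ Fin 3) ℂ).IsWeightedHomogeneous bidegree (0, 1) :=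
    Submodule.sum_mem (Bihom 0 1) fun i _ =>
      IsWeightedHomogeneous.C_mul (isWeightedHomogeneous_X ℂ bidegree (.inr i)) _
  have h := (h1.pow m).mul (h2.pow n)
  simpa [powerForm] using h

/-- The factorial of a multi-exponent. -/
def expFactorial (γ : Fin 3 ⊕ Fin 3 →₀ ℕ) : ℕ := ∏ s, (γ s).factorial

theorem expFactorial_ne_zero (γ : Fin 3 ⊕ Fin 3 →₀ ℕ) : (expFactorial γ : ℂ) ≠ 0 := by
  rw [Nat.cast_ne_zero]
  exact Finset.prod_ne_zero_iff.2 fun s _ => (γ s).factorial_ne_zero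

theorem expFactorial_add_single (γ : Fin 3 ⊕ Fin 3 →₀ ℕ) (s : Fin 3 ⊕ Fin 3) :
    expFactorial (γ + Finsupp.single s 1) = (γ s + 1) * expFactorial γ := by
  unfold expFactorial
  rw [← Finset.mul_prod_erase _ _ (Finset.mem_univ s),
    ← Finset.mul_prod_erase _ (fun s => (γ s).factorial) (Finset.mem_univ s), ← mul_assoc]
  congr 1
  · simp [Nat.factorial_succ]
  · refine Finset.prod_congr rfl fun r hr => ?_
    simp [(Finset.ne_of_mem_erase hr).symm]

theorem powerForm_eq (m n : ℕ) (x : Fin 3 ⊕ Fin 3 → ℂ) :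
    powerForm m n x = (m.factorial * n.factorial : ℂ) • ∑ γ ∈ biexponents m n,
      ((∏ s, x s ^ γ s) / expFactorial γ : ℂ) • monomial γ (1 : ℂ) := by
  have hmult : ∀ (N : ℕ) (k : Fin 3 → ℕ), k ∈ Finset.piAntidiag Finset.univ N →
      (Nat.multinomial Finset.univ k : ℂ) = N.factorial / ∏ i, ((k i).factorial : ℂ) := by
    intro N k hk
    have h1 := Nat.multinomial_spec Finset.univ k
    rw [(Finset.mem_piAntidiag.1 hk).1] at h1
    rw [← h1]
    have : (∏ i, ((k i).factorial : ℂ)) ≠ 0 :=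
      Finset.prod_ne_zero_iff.2 fun i _ => Nat.cast_ne_zero.2 (k i).factorial_ne_zero
    push_cast
    field_simp
  rw [powerForm, Finset.sum_pow_eq_sum_piAntidiag, Finset.sum_pow_eq_sum_piAntidiag,
    Finset.sum_mul_sum, sum_biexponents, Finset.smul_sum]
  refine Finset.sum_congr rfl fun k hk => ?_
  rw [Finset.smul_sum]
  refine Finset.sum_congr rfl fun l hl => ?_
  have hk' := hmult m k hk
  have hl' := hmult n l hl
  have hmon : (monomial (biexponent (k, l)) (1 : ℂ)) =
      (∏ i : Fin 3, X (.inl i) ^ k i) * ∏ i : Fin 3, X (.inr i) ^ l i := by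
    rw [monomial_eq, map_one, one_mul, Finsupp.prod_fintype _ _ (by simp), Fintype.prod_sum_type]
    simp [biexponent]
  rw [smul_smul, hmon, ← C_eq_coe_nat, ← C_eq_coe_nat]
  simp only [mul_pow, Finset.prod_mul_distrib, ← C_pow, ← map_prod, smul_eq_C_mul]
  have : (m.factorial * n.factorial : ℂ) * ((∏ s, x s ^ biexponent (k, l) s) /
      (expFactorial (biexponent (k, l)) : ℂ)) = (Nat.multinomial Finset.univ k : ℂ) *
        (Nat.multinomial Finset.univ l : ℂ) * (∏ i, x (.inl i) ^ k i) * ∏ i, x (.inr i) ^ l i := by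
    rw [hk', hl']
    simp only [Fintype.prod_sum_type, expFactorial, biexponent, Nat.cast_mul, Nat.cast_prod]
    simp only [Finsupp.equivFunOnFinite_symm_apply_apply, Sum.elim_inl, Sum.elim_inr]
    rw [mul_div_mul_comm]
    ring
  rw [this]
  simp only [map_mul, map_natCast]
  ring

/-- The forms `powerForm m n x`, for `x` a flag, together with the multiples of the quadric, span
all bihomogeneous polynomials of bidegree `(m, n)`. For a functional `f` that kills them,
`f (powerForm m n x)` is, up to the factor `m! n!`, the value at `x` of a polynomial `p` that
vanishes on the flags and is harmonic, hence is zero. -/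
theorem eq_zero_of_powerForm {m n : ℕ} (f : MvPolynomial (Fin 3 ⊕ Fin 3) ℂ →ₗ[ℂ] ℂ)
    (hQ : ∀ q, quadric * q ∈ Bihom m n → f (quadric * q) = 0)
    (hf : ∀ g : SL(3, ℂ), f (powerForm m n (flagPoint g)) = 0)
    {r : MvPolynomial (Fin 3 ⊕ Fin 3) ℂ} (hr : r ∈ Bihom m n) : f r = 0 := by
  let p : MvPolynomial (Fin 3 ⊕ Fin 3) ℂ :=
    ∑ γ ∈ biexponents m n, monomial γ (f (monomial γ 1) / expFactorial γ)
  have hp : p ∈ Bihom m n := Submodule.sum_mem _ fun γ hγ => monomial_mem_bihom hγ _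
  have hcoeff : ∀ γ, coeff γ p =
      if γ ∈ biexponents m n then f (monomial γ 1) / expFactorial γ else 0 := by
    intro γ
    simp only [p, coeff_sum, coeff_monomial, Finset.sum_ite_eq']
  have heval : ∀ x, (m.factorial * n.factorial : ℂ) * eval x p = f (powerForm m n x) := by
    intro x
    rw [powerForm_eq, map_smul, map_sum, smul_eq_mul]
    simp only [map_sum, map_smul, smul_eq_mul, eval_monomial]
    congr 1
    refine Finset.sum_congr rfl fun γ _ => ?_
    rw [Finsupp.prod_fintype _ _ (by simp)]
    ring
  have hdvd : quadric ∣ p := by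
    refine quadric_dvd_of_eval_flagPoint hp fun g => ?_
    have h := heval (flagPoint g)
    rw [hf] at h
    refine (mul_eq_zero.1 h).resolve_left ?_
    exact_mod_cast mul_ne_zero m.factorial_ne_zero n.factorial_ne_zero
  have hlap : laplacian p = 0 := by
    ext γ
    have h1 : ∀ i : Fin 3, coeff γ (pderiv (.inl i) (pderiv (.inr i) p)) =
        f (X (.inl i) * X (.inr i) * monomial γ 1) *
          (if (1, 1) + Finsupp.weight bidegree γ = (m, n) then 1 / (expFactorial γ : ℂ)
            else 0) := by
      intro i
      rw [coeff_pderiv, coeff_pderiv, hcoeff]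
      have h2 : γ + Finsupp.single (.inl i) 1 + Finsupp.single (.inr i) 1 ∈ biexponents m n ↔
          (1, 1) + Finsupp.weight bidegree γ = (m, n) := by
        rw [mem_biexponents, map_add, map_add, Finsupp.weight_single, Finsupp.weight_single,
          add_assoc, add_comm]
        simp [bidegree]
      have h3 : (X (.inl i) * X (.inr i) * monomial γ 1 : MvPolynomial (Fin 3 ⊕ Fin 3) ℂ) =
          monomial (γ + Finsupp.single (.inl i) 1 + Finsupp.single (.inr i) 1) 1 := by
        rw [X, X, monomial_mul, monomial_mul, add_comm _ γ, ← add_assoc, mul_one, mul_one]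
      rw [h3]
      simp only [h2]
      split_ifs
      · rw [expFactorial_add_single, expFactorial_add_single]
        have := expFactorial_ne_zero γ
        have e1 : ((γ (.inl i) : ℂ) + 1) ≠ 0 := by norm_cast
        have e2 : ((((γ + Finsupp.single (Sum.inl i) 1 : Fin 3 ⊕ Fin 3 →₀ ℕ) (Sum.inr i) : ℕ) : ℂ) +
            1) ≠ 0 := by norm_cast
        push_cast
        field_simp
      · simp
    rw [laplacian_apply, coeff_sum, coeff_zero, Finset.sum_congr rfl fun i _ => h1 i,
      ← Finset.sum_mul, ← map_sum, ← Finset.sum_mul]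
    split_ifs with h
    · have h4 := hQ (monomial γ 1) (by
        have := IsWeightedHomogeneous.mul quadric_mem
          (isWeightedHomogeneous_monomial bidegree γ (1 : ℂ) rfl)
        rwa [h] at this)
      rw [quadric] at h4
      rw [h4, zero_mul]
    · rw [mul_zero]
  have hp0 : p = 0 := by
    by_cases hmn : m = 0 ∨ n = 0
    · exact eq_zero_of_quadric_dvd hmn hp hdvd
    · obtain ⟨m, rfl⟩ := Nat.exists_eq_succ_of_ne_zero (not_or.1 hmn).1
      obtain ⟨n, rfl⟩ := Nat.exists_eq_succ_of_ne_zero (not_or.1 hmn).2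
      obtain ⟨q, hq, hpq⟩ := exists_bihom_eq_quadric_mul hp hdvd
      rw [hpq] at hlap
      rw [hpq, eq_zero_of_laplacian_quadric_pow_mul hq 0 (by simpa using hlap), mul_zero]
  rw [← sum_monomial_of_mem_bihom hr, map_sum]
  refine Finset.sum_eq_zero fun γ hγ => ?_
  have h5 := hcoeff γ
  rw [hp0, coeff_zero, if_pos hγ, eq_comm, div_eq_zero_iff] at h5
  have h6 := h5.resolve_right (expFactorial_ne_zero γ)
  rw [← mul_one (coeff γ r), ← smul_eq_mul, ← smul_monomial, map_smul, h6, smul_zero]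

end

/-! ### The character on the diagonal torus -/

section

open MvPolynomial

section Trace
variable {K X Y Z : Type*} [Field K] [AddCommGroup X] [Module K X] [FiniteDimensional K X]
  [AddCommGroup Y] [Module K Y] [FiniteDimensional K Y]
  [AddCommGroup Z] [Module K Z] [FiniteDimensional K Z]

/-- The trace is additive on short exact sequences. -/
theorem trace_eq_add_of_exact {i : Z →ₗ[K] X} {f : X →ₗ[K] Y} (hi : Function.Injective i)
    (hf : Function.Surjective f) (hif : Function.Exact i f) {S : Z →ₗ[K] Z} {T : X →ₗ[K] X}
    {R : Y →ₗ[K] Y} (hS : T ∘ₗ i = i ∘ₗ S) (hR : f ∘ₗ T = R ∘ₗ f) :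
    LinearMap.trace K X T = LinearMap.trace K Z S + LinearMap.trace K Y R := by
  obtain ⟨s, hs⟩ := f.exists_rightInverse_of_surjective (LinearMap.range_eq_top.2 hf)
  obtain ⟨r, hr⟩ := i.exists_leftInverse_of_injective (LinearMap.ker_eq_bot.2 hi)
  have hid : i ∘ₗ (r ∘ₗ (LinearMap.id - s ∘ₗ f)) + s ∘ₗ f = LinearMap.id := by
    ext x
    obtain ⟨z, hz⟩ := (hif (x - s (f x))).1 (by
      have := LinearMap.congr_fun hs (f x)
      simp only [LinearMap.comp_apply, LinearMap.id_apply] at this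
      rw [map_sub, this, sub_self])
    have h1 : r (i z) = z := LinearMap.congr_fun hr z
    simp only [LinearMap.add_apply, LinearMap.comp_apply, LinearMap.sub_apply, LinearMap.id_apply]
    rw [← hz, h1, hz, sub_add_cancel]
  have hri : (r ∘ₗ (LinearMap.id - s ∘ₗ f)) ∘ₗ i = LinearMap.id := by
    ext z
    have h1 : r (i z) = z := LinearMap.congr_fun hr z
    have h2 : f (i z) = 0 := (hif _).2 ⟨z, rfl⟩
    simp [h1, h2]
  calc LinearMap.trace K X T
      = LinearMap.trace K X (T ∘ₗ (i ∘ₗ (r ∘ₗ (LinearMap.id - s ∘ₗ f)) + s ∘ₗ f)) := by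
        rw [hid, LinearMap.comp_id]
    _ = LinearMap.trace K X ((i ∘ₗ S) ∘ₗ (r ∘ₗ (LinearMap.id - s ∘ₗ f))) +
          LinearMap.trace K X ((T ∘ₗ s) ∘ₗ f) := by
        rw [LinearMap.comp_add, map_add, ← LinearMap.comp_assoc, hS]
        rfl
    _ = LinearMap.trace K Z S + LinearMap.trace K Y R := by
        rw [LinearMap.trace_comp_comm', LinearMap.trace_comp_comm' f (T ∘ₗ s),
          ← LinearMap.comp_assoc, hri, ← LinearMap.comp_assoc, hR, LinearMap.comp_assoc, hs,
          LinearMap.id_comp, LinearMap.comp_id]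

end Trace

theorem trace_eq_sum_of_basis {K X ι : Type*} [Field K] [AddCommGroup X] [Module K X]
    [Fintype ι] (b : Module.Basis ι K X) (T : X →ₗ[K] X)
    (c : ι → K) (h : ∀ j, T (b j) = c j • b j) : LinearMap.trace K X T = ∑ j, c j := by
  classical
  rw [LinearMap.trace_eq_matrix_trace K b, Matrix.trace]
  refine Finset.sum_congr rfl fun j _ => ?_
  simp [LinearMap.toMatrix_apply, h]

/-- The action of the diagonal matrix with entries `d` on polynomials: `aᵢ` is multiplied by `dᵢ`
and `bᵢ` by `dᵢ⁻¹`. -/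
def torusAction (d : Fin 3 → ℂ) :
    MvPolynomial (Fin 3 ⊕ Fin 3) ℂ →ₐ[ℂ] MvPolynomial (Fin 3 ⊕ Fin 3) ℂ :=
  aeval fun s => C (Sum.elim d (fun i => (d i)⁻¹) s) * X s

theorem torusAction_monomial (d : Fin 3 → ℂ) (γ : Fin 3 ⊕ Fin 3 →₀ ℕ) (c : ℂ) :
    torusAction d (monomial γ c) =
      (∏ s, Sum.elim d (fun i => (d i)⁻¹) s ^ γ s) • monomial γ c := by
  rw [torusAction, aeval_monomial, Finsupp.prod_fintype _ _ (by simp), monomial_eq,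
    Finsupp.prod_fintype _ _ (by simp)]
  simp only [mul_pow, Finset.prod_mul_distrib, ← C_pow, ← map_prod, smul_eq_C_mul,
    algebraMap_eq]
  ring

theorem torusAction_mem (d : Fin 3 → ℂ) {m n : ℕ} {p : MvPolynomial (Fin 3 ⊕ Fin 3) ℂ}
    (hp : p ∈ Bihom m n) : torusAction d p ∈ Bihom m n := by
  rw [← sum_monomial_of_mem_bihom hp, map_sum]
  refine Submodule.sum_mem _ fun γ hγ => ?_
  rw [torusAction_monomial]
  exact Submodule.smul_mem _ _ (monomial_mem_bihom hγ _)

theorem eval_torusAction (d : Fin 3 → ℂ) (x : Fin 3 ⊕ Fin 3 → ℂ)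
    (p : MvPolynomial (Fin 3 ⊕ Fin 3) ℂ) : eval x (torusAction d p) =
      eval (fun s => Sum.elim d (fun i => (d i)⁻¹) s * x s) p := by
  induction p using MvPolynomial.induction_on with
  | C c => simp [torusAction]
  | add p q hp hq => simp [hp, hq]
  | mul_X p s hp => rw [map_mul, map_mul, map_mul, hp]; simp [torusAction]

theorem torusAction_quadric {d : Fin 3 → ℂ} (hd : ∀ i, d i ≠ 0) :
    torusAction d quadric = quadric := by
  simp only [quadric, map_sum, map_mul]
  refine Finset.sum_congr rfl fun i _ => ?_
  simp only [torusAction, aeval_X, Sum.elim_inl, Sum.elim_inr]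
  rw [mul_mul_mul_comm, ← C_mul, mul_inv_cancel₀ (hd i), C_1, one_mul]

/-- The complete homogeneous symmetric function `h_m` of three numbers. -/
def completeHomogeneous (e : Fin 3 → ℂ) (m : ℕ) : ℂ :=
  ∑ k ∈ Finset.piAntidiag Finset.univ m, ∏ i, e i ^ k i

/-- The restriction of `torusAction` to bihomogeneous polynomials. -/
def torusBihom (d : Fin 3 → ℂ) (m n : ℕ) : Bihom m n →ₗ[ℂ] Bihom m n :=
  (torusAction d).toLinearMap.restrict fun _ hp => torusAction_mem d hp

theorem trace_torusBihom (d : Fin 3 → ℂ) (m n : ℕ) :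
    LinearMap.trace ℂ (Bihom m n) (torusBihom d m n) =
      completeHomogeneous d m * completeHomogeneous (fun i => (d i)⁻¹) n := by
  rw [trace_eq_sum_of_basis (bihomBasis m n) _
    (fun γ => ∏ s, Sum.elim d (fun i => (d i)⁻¹) s ^ γ.1 s)]
  · rw [Finset.sum_coe_sort (biexponents m n)
      fun γ => ∏ s, Sum.elim d (fun i => (d i)⁻¹) s ^ γ s, sum_biexponents,
      completeHomogeneous, completeHomogeneous, Finset.sum_mul_sum]
    simp [Fintype.prod_sum_type, biexponent]
  · intro γ
    ext1
    rw [Submodule.coe_smul, coe_bihomBasis, ← torusAction_monomial, ← coe_bihomBasis]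
    rfl

theorem flagPoint_mul_diagonal (g D : SL(3, ℂ)) {d : Fin 3 → ℂ} (hD : D.1 = Matrix.diagonal d) :
    flagPoint (g * D) = fun s => Sum.elim d (fun i => (d i)⁻¹) s * flagPoint g s := by
  have hdet := D.2
  rw [hD, Matrix.det_diagonal, Fin.prod_univ_three] at hdet
  have h0 : d 0 ≠ 0 := by rintro h; simp [h] at hdet
  have h1 : d 1 ≠ 0 := by rintro h; simp [h] at hdet
  have h2 : d 2 ≠ 0 := by rintro h; simp [h] at hdet
  have hmul : ∀ i j, (g * D).1 i j = g.1 i j * d j := by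
    intro i j
    rw [Matrix.SpecialLinearGroup.coe_mul, hD, Matrix.mul_diagonal]
  funext s
  rcases s with i | i
  · change (g * D).1 0 i = d i * g.1 0 i
    rw [hmul, mul_comm]
  · fin_cases i
    · simp [flagPoint, hmul]
      field_simp
      linear_combination (g.1 0 1 * g.1 1 2 - g.1 0 2 * g.1 1 1) * hdet
    · simp [flagPoint, hmul]
      field_simp
      linear_combination (g.1 0 2 * g.1 1 0 - g.1 0 0 * g.1 1 2) * hdet
    · simp [flagPoint, hmul]
      field_simp
      linear_combination (g.1 0 0 * g.1 1 1 - g.1 0 1 * g.1 1 0) * hdet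

/-- The Cauchy–Binet formula expresses the leading minors of `g * h` through the flag coordinates
of `g` and of the transpose of `h`. -/
theorem eval_flagPoint_powerForm (m n : ℕ) (g h : SL(3, ℂ)) :
    eval (flagPoint g) (powerForm m n (flagPoint h.transpose)) =
      (g * h).1 0 0 ^ m * leadingMinor (g * h) ^ n := by
  simp only [powerForm, map_mul, map_pow, Fin.sum_univ_three]
  congr 2
  · rw [specialLinear_mul_apply]
    simp [flagPoint, Matrix.SpecialLinearGroup.transpose]
    ring
  · simp only [leadingMinor, specialLinear_mul_apply]
    simp [flagPoint, Matrix.SpecialLinearGroup.transpose]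
    ring

theorem eq_bot_or_eq_top_of_isIrreducible {G W : Type*} [Group G] [AddCommGroup W] [Module ℂ W]
    {π : Representation ℂ G W} (hπ : π.IsIrreducible) (p : Submodule ℂ W)
    (hp : ∀ g, ∀ v ∈ p, π g v ∈ p) : p = ⊥ ∨ p = ⊤ := by
  rcases hπ.eq_bot_or_eq_top ⟨p, fun g v hv => hp g v hv⟩ with h | h
  · exact .inl (congrArg Subrepresentation.toSubmodule h)
  · exact .inr (congrArg Subrepresentation.toSubmodule h)

/-- Evaluation of bihomogeneous polynomials on the flags of elements of `SL₃(ℂ)`. -/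
def evalFlag (m n : ℕ) : Bihom m n →ₗ[ℂ] SL(3, ℂ) → ℂ where
  toFun p g := eval (flagPoint g) p.1
  map_add' p q := by ext; simp
  map_smul' c p := by ext; simp

/-- The simple module of highest weight `m ϖ₁ + n ϖ₂` is the quotient of the bihomogeneous
polynomials of bidegree `(m, n)` by the multiples of the quadric. Both are realized as functions of
`g`: a vector `v` through the coefficient `φ (π g v)`, a polynomial through its value at
`flagPoint g`. Only the equivariance under diagonal matrices is recorded. -/
theorem exists_bihom_surjective {W : Type*} [AddCommGroup W] [Module ℂ W]
    {π : Representation ℂ SL(3, ℂ) W} {m n : ℕ} (hπ : IsSimpleOfHighestWeight π m n) :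
    ∃ f : Bihom m n →ₗ[ℂ] W, Function.Surjective f ∧ (∀ p, f p = 0 ↔ quadric ∣ p.1) ∧
      ∀ (D : SL(3, ℂ)) (d : Fin 3 → ℂ), D.1 = Matrix.diagonal d →
        f ∘ₗ torusBihom d m n = π D ∘ₗ f := by
  obtain ⟨w, hw⟩ := hπ.exists_highestWeightVector
  obtain ⟨φ, hφ⟩ := exists_dual_apply_eq hπ.rational hw
  let Φ : W →ₗ[ℂ] SL(3, ℂ) → ℂ := LinearMap.pi fun g => φ ∘ₗ π g
  have hΦ : ∀ v g, Φ v g = φ (π g v) := fun v g => rfl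
  -- the kernel of `Φ` is invariant and does not contain `w`
  have hker : LinearMap.ker Φ = ⊥ := by
    refine (eq_bot_or_eq_top_of_isIrreducible hπ.irreducible _ fun g v hv => ?_).resolve_right ?_
    · rw [LinearMap.mem_ker] at hv ⊢
      funext h
      rw [hΦ, ← Module.End.mul_apply, ← map_mul, ← hΦ, hv]
      rfl
    · intro h
      have h1 : Φ w = 0 := LinearMap.mem_ker.1 (h ▸ Submodule.mem_top)
      have h2 := hφ 1
      rw [← hΦ, h1] at h2
      simp [leadingMinor] at h2
  have hspan : Submodule.span ℂ (Set.range fun g => π g w) = ⊤ := by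
    refine (eq_bot_or_eq_top_of_isIrreducible hπ.irreducible _ fun g v hv => ?_).resolve_left ?_
    · have : Submodule.span ℂ (Set.range fun g => π g w) ≤
          (Submodule.span ℂ (Set.range fun g => π g w)).comap (π g) := by
        rw [Submodule.span_le]
        rintro _ ⟨h, rfl⟩
        refine Submodule.subset_span ⟨g * h, ?_⟩
        simp
      exact this hv
    · intro h
      refine hw.1 ((Submodule.mem_bot ℂ).1 (h ▸ Submodule.subset_span ⟨1, ?_⟩))
      simp
  have hΦw : ∀ h : SL(3, ℂ), Φ (π h w) =
      evalFlag m n ⟨powerForm m n (flagPoint h.transpose), powerForm_mem m n _⟩ := by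
    intro h
    funext g
    rw [hΦ, ← Module.End.mul_apply, ← map_mul, hφ]
    exact (eval_flagPoint_powerForm m n g h).symm
  have hrange : ∀ p : Bihom m n, evalFlag m n p ∈ LinearMap.range Φ := by
    intro p
    by_contra hp
    -- separate `p` from the polynomials whose values come from `W`
    let P : Submodule ℂ (MvPolynomial (Fin 3 ⊕ Fin 3) ℂ) :=
      ((LinearMap.range Φ).comap (evalFlag m n)).map (Bihom m n).subtype
    have hpP : p.1 ∉ P := by
      rintro ⟨q, hq, hqp⟩
      have : q = p := Subtype.ext hqp
      exact hp (this ▸ hq)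
    obtain ⟨f, hfp, hf⟩ := Submodule.exists_dual_map_eq_bot_of_notMem hpP inferInstance
    have hf0 : ∀ q ∈ P, f q = 0 := by
      intro q hq
      have : f q ∈ P.map f := Submodule.mem_map_of_mem hq
      rwa [hf, Submodule.mem_bot] at this
    refine hfp (eq_zero_of_powerForm f (fun q hq => hf0 _ ⟨⟨_, hq⟩, ?_, rfl⟩) (fun g => ?_) p.2)
    · have : evalFlag m n ⟨_, hq⟩ = 0 := by
        funext g
        simp [evalFlag, eval_flagPoint_quadric]
      simp only [SetLike.mem_coe, Submodule.mem_comap]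
      rw [this]
      exact Submodule.zero_mem _
    · refine hf0 _ ⟨⟨_, powerForm_mem m n _⟩, ?_, rfl⟩
      refine ⟨π g.transpose w, ?_⟩
      rw [hΦw]
      rfl
  let e := LinearEquiv.ofInjective Φ (LinearMap.ker_eq_bot.1 hker)
  let f : Bihom m n →ₗ[ℂ] W := e.symm.toLinearMap ∘ₗ (evalFlag m n).codRestrict _ hrange
  have hf : ∀ p, Φ (f p) = evalFlag m n p := by
    intro p
    have := congrArg Subtype.val (e.apply_symm_apply ((evalFlag m n).codRestrict _ hrange p))
    exact this
  have hinj := LinearMap.ker_eq_bot.1 hker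
  refine ⟨f, ?_, ?_, ?_⟩
  · rw [← LinearMap.range_eq_top, eq_top_iff, ← hspan, Submodule.span_le]
    rintro _ ⟨h, rfl⟩
    refine ⟨⟨powerForm m n (flagPoint h.transpose), powerForm_mem m n _⟩, hinj ?_⟩
    rw [hf, hΦw]
  · intro p
    rw [← map_eq_zero_iff Φ hinj, hf]
    constructor
    · intro h
      exact quadric_dvd_of_eval_flagPoint p.2 fun g => congrFun h g
    · rintro ⟨q, hq⟩
      funext g
      simp [evalFlag, hq, eval_flagPoint_quadric]
  · intro D d hD
    ext p
    apply hinj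
    funext g
    simp only [LinearMap.comp_apply]
    rw [hf, hΦ, ← Module.End.mul_apply, ← map_mul, ← hΦ, hf]
    change eval (flagPoint g) (torusAction d p.1) = eval (flagPoint (g * D)) p.1
    rw [eval_torusAction, flagPoint_mul_diagonal g D hD]

/-- The character of `π_{m, n}` on the diagonal torus, with the convention that the complete
homogeneous symmetric functions of negative degree vanish. -/
theorem trace_diagonal {W : Type*} [AddCommGroup W] [Module ℂ W]
    {π : Representation ℂ SL(3, ℂ) W} {m n : ℕ} (hπ : IsSimpleOfHighestWeight π m n)
    (D : SL(3, ℂ)) (d : Fin 3 → ℂ) (hD : D.1 = Matrix.diagonal d) :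
    LinearMap.trace ℂ W (π D) =
      completeHomogeneous d m * completeHomogeneous (fun i => (d i)⁻¹) n -
        if m = 0 ∨ n = 0 then 0 else
          completeHomogeneous d (m - 1) * completeHomogeneous (fun i => (d i)⁻¹) (n - 1) := by
  have := hπ.finiteDimensional
  obtain ⟨f, hsurj, hker, hequiv⟩ := exists_bihom_surjective hπ
  have hd : ∀ i, d i ≠ 0 := by
    have hdet := D.2
    rw [hD, Matrix.det_diagonal] at hdet
    intro i hi
    rw [Finset.prod_eq_zero (Finset.mem_univ i) hi] at hdet
    exact zero_ne_one hdet
  rw [← trace_torusBihom]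
  split_ifs with hmn
  · have hinj : Function.Injective f := by
      rw [← LinearMap.ker_eq_bot, eq_bot_iff]
      intro p hp
      exact Subtype.ext (eq_zero_of_quadric_dvd hmn p.2 ((hker p).1 hp))
    have h := trace_eq_add_of_exact (i := (0 : PUnit →ₗ[ℂ] Bihom m n)) (f := f) (S := 0)
      (T := torusBihom d m n) (R := π D) (Function.injective_of_subsingleton _) hsurj
      (fun p => by simp [map_eq_zero_iff f hinj, eq_comm]) (by simp) (hequiv D d hD)
    rw [h, map_zero, zero_add, sub_zero]
  · obtain ⟨m, rfl⟩ := Nat.exists_eq_succ_of_ne_zero (not_or.1 hmn).1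
    obtain ⟨n, rfl⟩ := Nat.exists_eq_succ_of_ne_zero (not_or.1 hmn).2
    let i : Bihom m n →ₗ[ℂ] Bihom (m + 1) (n + 1) :=
      (LinearMap.mulLeft ℂ quadric).restrict fun q hq => by
        have := quadric_pow_mul_mem hq 1
        simpa [add_comm 1] using this
    have hi : ∀ q, (i q).1 = quadric * q.1 := fun q => rfl
    have h := trace_eq_add_of_exact (i := i) (f := f) (S := torusBihom d m n)
      (T := torusBihom d (m + 1) (n + 1)) (R := π D)
      (fun q r h => Subtype.ext (mul_left_cancel₀ quadric_ne_zero (congrArg Subtype.val h)))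
      hsurj (fun p => by
        rw [hker]
        constructor
        · intro h
          obtain ⟨q, hq, hpq⟩ := exists_bihom_eq_quadric_mul p.2 h
          exact ⟨⟨q, hq⟩, Subtype.ext hpq.symm⟩
        · rintro ⟨q, rfl⟩
          exact ⟨q, rfl⟩)
      (by
        ext1 q
        refine Subtype.ext ?_
        change torusAction d (quadric * q.1) = quadric * torusAction d q.1
        rw [map_mul, torusAction_quadric hd]) (hequiv D d hD)
    rw [h, trace_torusBihom]
    simp

end

/-! ### Generating functions of characters -/

/-- A linear map of finite order on `ℂ³` has a basis of eigenvectors. -/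
theorem exists_eigenbasis (f : Module.End ℂ (Fin 3 → ℂ)) {k : ℕ} (hk : k ≠ 0) (hf : f ^ k = 1) :
    ∃ (b : Module.Basis (Fin 3) ℂ (Fin 3 → ℂ)) (d : Fin 3 → ℂ), ∀ j, f (b j) = d j • b j := by
  have hss : f.IsSemisimple := by
    refine Module.End.isSemisimple_of_squarefree_aeval_eq_zero
      (p := (Polynomial.X ^ k - 1 : Polynomial ℂ)) ?_ (by simp [hf])
    exact (Polynomial.X_pow_sub_one_separable_iff.2 (Nat.cast_ne_zero.2 hk)).squarefree
  have htop := hss.iSup_eigenspace_eq_top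
  obtain ⟨B, hB, hspan, hli⟩ := exists_linearIndependent ℂ {v | ∃ μ : ℂ, f v = μ • v}
  have hspan' : Submodule.span ℂ B = ⊤ := by
    rw [hspan, eq_top_iff, ← htop, iSup_le_iff]
    intro μ v hv
    exact Submodule.subset_span ⟨μ, Module.End.mem_eigenspace_iff.1 hv⟩
  let b := Module.Basis.mk hli (by simp [hspan'])
  let e := b.indexEquiv (Pi.basisFun ℂ (Fin 3))
  have h : ∀ j, ∃ μ : ℂ, f (b.reindex e j) = μ • b.reindex e j := by
    intro j
    rw [Module.Basis.reindex_apply, Module.Basis.mk_apply]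
    exact hB (e.symm j).2
  choose d hd using h
  exact ⟨b.reindex e, d, hd⟩

/-- An element of finite order of `SL₃(ℂ)` is conjugate in `SL₃(ℂ)` to a diagonal matrix. -/
theorem exists_conj_diagonal {g : SL(3, ℂ)} (hg : IsOfFinOrder g) :
    ∃ (P D : SL(3, ℂ)) (d : Fin 3 → ℂ), D.1 = Matrix.diagonal d ∧ g * P = P * D ∧
      ∀ i, ‖d i‖ = 1 := by
  obtain ⟨k, hk, hgk⟩ := isOfFinOrder_iff_pow_eq_one.1 hg
  obtain ⟨b, d, hb⟩ := exists_eigenbasis (Matrix.toLin' g.1) hk.ne' (by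
    rw [← Matrix.toLin'_pow, ← Matrix.SpecialLinearGroup.coe_pow, hgk,
      Matrix.SpecialLinearGroup.coe_one, Matrix.toLin'_one]
    rfl)
  have hpow : ∀ (n : ℕ) i, (Matrix.toLin' g.1 ^ n) (b i) = d i ^ n • b i := by
    intro n i
    induction n with
    | zero => simp
    | succ n ih => rw [pow_succ', Module.End.mul_apply, ih, map_smul, hb, smul_smul, pow_succ]
  have hd : ∀ i, ‖d i‖ = 1 := by
    intro i
    have h := hpow k i
    rw [← Matrix.toLin'_pow, ← Matrix.SpecialLinearGroup.coe_pow, hgk,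
      Matrix.SpecialLinearGroup.coe_one, Matrix.toLin'_one, LinearMap.id_apply] at h
    have h1 : d i ^ k = 1 := by
      have : (d i ^ k - 1) • b i = 0 := by rw [sub_smul, ← h, one_smul, sub_self]
      exact sub_eq_zero.1 ((smul_eq_zero.1 this).resolve_right (b.ne_zero i))
    exact Complex.norm_eq_one_of_pow_eq_one h1 hk.ne'
  have hdet : ((Pi.basisFun ℂ (Fin 3)).toMatrix b).det ≠ 0 :=
    ((Pi.basisFun ℂ (Fin 3)).isUnit_det b).ne_zero
  set Q := (Pi.basisFun ℂ (Fin 3)).toMatrix b with hQ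
  have hQapp : ∀ i j, Q i j = b j i := fun i j => by simp [hQ, Module.Basis.toMatrix_apply]
  -- the first eigenvector is rescaled so that the matrix of eigenvectors has determinant one
  let s : Fin 3 → ℂ := ![Q.det⁻¹, 1, 1]
  have hP : (Q * Matrix.diagonal s).det = 1 := by
    rw [Matrix.det_mul, Matrix.det_diagonal, Fin.prod_univ_three]
    simp [s, hdet]
  have hgQ : g.1 * Q = Q * Matrix.diagonal d := by
    ext i j
    have h := congrFun (hb j) i
    rw [Matrix.toLin'_apply] at h
    rw [Matrix.mul_diagonal, Matrix.mul_apply, hQapp]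
    simp only [hQapp]
    rw [Pi.smul_apply, smul_eq_mul, mul_comm] at h
    exact h
  have hcomm : Matrix.diagonal d * Matrix.diagonal s = Matrix.diagonal s * Matrix.diagonal d := by
    rw [Matrix.diagonal_mul_diagonal, Matrix.diagonal_mul_diagonal]
    simp only [mul_comm]
  have hD : (Matrix.diagonal d).det = 1 := by
    have h := congrArg Matrix.det hgQ
    rw [Matrix.det_mul, Matrix.det_mul, g.2, one_mul] at h
    exact mul_left_cancel₀ hdet (by rw [mul_one, ← h])
  refine ⟨⟨Q * Matrix.diagonal s, hP⟩, ⟨Matrix.diagonal d, hD⟩, d, rfl, ?_, hd⟩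
  refine Subtype.ext ?_
  change g.1 * (Q * Matrix.diagonal s) = Q * Matrix.diagonal s * Matrix.diagonal d
  rw [← mul_assoc, hgQ, mul_assoc, hcomm, mul_assoc]

open PowerSeries in
theorem mk_pow_mul_one_sub (a : ℂ) : (mk fun n => a ^ n) * (1 - C a * X) = 1 := by
  ext n
  rw [mul_sub, mul_one, map_sub, ← mul_assoc, mul_comm _ (C a)]
  rcases n with _ | n
  · simp
  · rw [coeff_succ_mul_X, coeff_C_mul, coeff_mk, coeff_mk, coeff_one]
    simp [pow_succ']

open PowerSeries in
/-- The generating function of the complete homogeneous symmetric functions. -/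
theorem mk_completeHomogeneous (e : Fin 3 → ℂ) :
    mk (completeHomogeneous e) = ∏ i, mk fun n => e i ^ n := by
  ext n
  rw [coeff_mk, coeff_prod, completeHomogeneous]
  refine Finset.sum_nbij' (fun k => Finsupp.equivFunOnFinite.symm k) (fun l => ⇑l) ?_ ?_ ?_ ?_ ?_
  · intro k hk
    simpa [Finset.mem_finsuppAntidiag, Finset.mem_piAntidiag] using hk
  · intro k hk
    simpa [Finset.mem_finsuppAntidiag, Finset.mem_piAntidiag] using hk
  · intro k _
    rfl
  · intro k _
    ext; simp
  · intro k _
    simp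

open PowerSeries in
/-- The generating function of the complete homogeneous symmetric functions of three numbers with
product `1` is the inverse of `∏ i, (1 - eᵢ X)`, whose coefficients are elementary symmetric. -/
theorem mk_completeHomogeneous_mul (e : Fin 3 → ℂ) (he : e 0 * e 1 * e 2 = 1) (c₁ c₂ : ℂ)
    (h₁ : e 0 + e 1 + e 2 = c₁) (h₂ : e 0 * e 1 + e 0 * e 2 + e 1 * e 2 = c₂) :
    (1 - C c₁ * X + C c₂ * X ^ 2 - X ^ 3) * mk (completeHomogeneous e) = 1 := by
  have h : (1 - C c₁ * X + C c₂ * X ^ 2 - X ^ 3 : PowerSeries ℂ) = ∏ i, (1 - C (e i) * X) := by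
    have h3 : (C (e 0) * C (e 1) * C (e 2) : PowerSeries ℂ) = 1 := by
      rw [← map_mul, ← map_mul, he, map_one]
    rw [← h₁, ← h₂, Fin.prod_univ_three]
    simp only [map_add, map_mul]
    linear_combination X ^ 3 * h3
  rw [h, mk_completeHomogeneous, ← Finset.prod_mul_distrib]
  refine Finset.prod_eq_one fun i _ => ?_
  rw [mul_comm, mk_pow_mul_one_sub]

/-- The product `a(t) b(u)` of two power series in one variable. -/
def sepSeries (a b : PowerSeries ℂ) : MvPowerSeries (Fin 2) ℂ :=
  fun s => PowerSeries.coeff (s 0) a * PowerSeries.coeff (s 1) b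

theorem coeff_sepSeries (a b : PowerSeries ℂ) (s : Fin 2 →₀ ℕ) :
    MvPowerSeries.coeff s (sepSeries a b) =
      PowerSeries.coeff (s 0) a * PowerSeries.coeff (s 1) b := rfl

theorem X_zero_mul_sepSeries (a b : PowerSeries ℂ) :
    MvPowerSeries.X 0 * sepSeries a b = sepSeries (PowerSeries.X * a) b := by
  ext s
  rw [MvPowerSeries.X, MvPowerSeries.coeff_monomial_mul, coeff_sepSeries, coeff_sepSeries]
  rcases h : s 0 with _ | k
  · simp [Finsupp.single_le_iff, h]
  · simp [Finsupp.single_le_iff, h, PowerSeries.coeff_succ_X_mul]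

theorem X_one_mul_sepSeries (a b : PowerSeries ℂ) :
    MvPowerSeries.X 1 * sepSeries a b = sepSeries a (PowerSeries.X * b) := by
  ext s
  rw [MvPowerSeries.X, MvPowerSeries.coeff_monomial_mul, coeff_sepSeries, coeff_sepSeries]
  rcases h : s 1 with _ | k
  · simp [Finsupp.single_le_iff, h]
  · simp [Finsupp.single_le_iff, h, PowerSeries.coeff_succ_X_mul]

theorem C_mul_sepSeries_left (c : ℂ) (a b : PowerSeries ℂ) :
    MvPowerSeries.C c * sepSeries a b = sepSeries (PowerSeries.C c * a) b := by
  ext s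
  simp [coeff_sepSeries, mul_assoc]

theorem C_mul_sepSeries_right (c : ℂ) (a b : PowerSeries ℂ) :
    MvPowerSeries.C c * sepSeries a b = sepSeries a (PowerSeries.C c * b) := by
  ext s
  simp [coeff_sepSeries, mul_left_comm]

theorem sepSeries_add_left (a a' b : PowerSeries ℂ) :
    sepSeries (a + a') b = sepSeries a b + sepSeries a' b := by
  ext s; simp [coeff_sepSeries, add_mul]

theorem sepSeries_sub_left (a a' b : PowerSeries ℂ) :
    sepSeries (a - a') b = sepSeries a b - sepSeries a' b := by
  ext s; simp [coeff_sepSeries, sub_mul]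

theorem sepSeries_add_right (a b b' : PowerSeries ℂ) :
    sepSeries a (b + b') = sepSeries a b + sepSeries a b' := by
  ext s; simp [coeff_sepSeries, mul_add]

theorem sepSeries_sub_right (a b b' : PowerSeries ℂ) :
    sepSeries a (b - b') = sepSeries a b - sepSeries a b' := by
  ext s; simp [coeff_sepSeries, mul_sub]

theorem sepSeries_one_one : sepSeries 1 1 = 1 := by
  ext s
  rw [coeff_sepSeries, PowerSeries.coeff_one, PowerSeries.coeff_one, MvPowerSeries.coeff_one]
  have h : s = 0 ↔ s 0 = 0 ∧ s 1 = 0 := by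
    rw [Finsupp.ext_iff, Fin.forall_fin_two]
    rfl
  simp only [h, ite_and, mul_ite, mul_one, mul_zero]
  split_ifs <;> rfl

/-- The cubic `1 - c₁ X + c₂ X² - X³` in the variable of index `i`; its factors have the order
in which they occur in `ratF`. -/
def cubicSeries (i : Fin 2) (c₁ c₂ : ℂ) : MvPowerSeries (Fin 2) ℂ :=
  1 - MvPowerSeries.X i * MvPowerSeries.C c₁ + MvPowerSeries.X i ^ 2 * MvPowerSeries.C c₂ -
    MvPowerSeries.X i ^ 3

theorem cubicSeries_zero_mul_sepSeries (c₁ c₂ : ℂ) (a b : PowerSeries ℂ) :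
    cubicSeries 0 c₁ c₂ * sepSeries a b = sepSeries ((1 - PowerSeries.C c₁ * PowerSeries.X +
      PowerSeries.C c₂ * PowerSeries.X ^ 2 - PowerSeries.X ^ 3) * a) b := by
  simp only [cubicSeries, sub_mul, add_mul, one_mul, sepSeries_sub_left, sepSeries_add_left,
    mul_assoc, pow_succ, pow_zero, ← X_zero_mul_sepSeries, ← C_mul_sepSeries_left]
  ring

theorem cubicSeries_one_mul_sepSeries (c₁ c₂ : ℂ) (a b : PowerSeries ℂ) :
    cubicSeries 1 c₁ c₂ * sepSeries a b = sepSeries a ((1 - PowerSeries.C c₁ * PowerSeries.X +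
      PowerSeries.C c₂ * PowerSeries.X ^ 2 - PowerSeries.X ^ 3) * b) := by
  simp only [cubicSeries, sub_mul, add_mul, one_mul, sepSeries_sub_right, sepSeries_add_right,
    mul_assoc, pow_succ, pow_zero, ← X_one_mul_sepSeries, ← C_mul_sepSeries_right]
  ring

/-- The generating function `∑ tr(π_{m, n}(g)) t ^ m u ^ n`. -/
def characterSeries {V : ℕ → ℕ → Type*} [∀ m n, AddCommGroup (V m n)]
    [∀ m n, Module ℂ (V m n)] (π : ∀ m n, Representation ℂ SL(3, ℂ) (V m n)) (g : SL(3, ℂ)) :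
    MvPowerSeries (Fin 2) ℂ :=
  fun s => (π (s 0) (s 1)).character g

/-- The generating function of the characters of the `π_{m, n}` at an element of finite order. -/
theorem characterSeries_eq {V : ℕ → ℕ → Type*} [∀ m n, AddCommGroup (V m n)]
    [∀ m n, Module ℂ (V m n)] {π : ∀ m n, Representation ℂ SL(3, ℂ) (V m n)}
    (hπ : ∀ m n, IsSimpleOfHighestWeight (π m n) m n) {g : SL(3, ℂ)} (hg : IsOfFinOrder g) :
    cubicSeries 0 g.1.trace (starRingEnd ℂ g.1.trace) *
      cubicSeries 1 (starRingEnd ℂ g.1.trace) g.1.trace *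
      characterSeries π g =
    1 - MvPowerSeries.X 0 * MvPowerSeries.X 1 := by
  obtain ⟨P, D, d, hD, hgP, hd⟩ := exists_conj_diagonal hg
  have hdet := D.2
  rw [hD, Matrix.det_diagonal, Fin.prod_univ_three] at hdet
  have h0 : d 0 ≠ 0 := by rintro h; simp [h] at hdet
  have h1 : d 1 ≠ 0 := by rintro h; simp [h] at hdet
  have h2 : d 2 ≠ 0 := by rintro h; simp [h] at hdet
  have hgc : g = P * D * P⁻¹ := by rw [← hgP, mul_inv_cancel_right]
  have htr : g.1.trace = d 0 + d 1 + d 2 := by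
    rw [hgc, Matrix.SpecialLinearGroup.coe_mul, Matrix.trace_mul_comm,
      ← Matrix.SpecialLinearGroup.coe_mul, inv_mul_cancel_left, hD, Matrix.trace_diagonal,
      Fin.sum_univ_three]
  have hconj : starRingEnd ℂ g.1.trace = (d 0)⁻¹ + (d 1)⁻¹ + (d 2)⁻¹ := by
    rw [htr, map_add, map_add, Complex.inv_eq_conj (hd 0), Complex.inv_eq_conj (hd 1),
      Complex.inv_eq_conj (hd 2)]
  have hinv : (d 0)⁻¹ * (d 1)⁻¹ * (d 2)⁻¹ = 1 := by
    rw [← mul_inv, ← mul_inv, hdet, inv_one]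
  have hA := mk_completeHomogeneous_mul d hdet g.1.trace (starRingEnd ℂ g.1.trace) htr.symm (by
    rw [hconj]
    field_simp
    linear_combination (d 0 * d 1 + d 0 * d 2 + d 1 * d 2) * hdet)
  have hB := mk_completeHomogeneous_mul (fun i => (d i)⁻¹) hinv (starRingEnd ℂ g.1.trace)
    g.1.trace hconj.symm (by
      rw [htr]
      field_simp
      linear_combination (-(d 0 + d 1 + d 2)) * hdet)
  set A := PowerSeries.mk (completeHomogeneous d) with hAdef
  set B := PowerSeries.mk (completeHomogeneous fun i => (d i)⁻¹) with hBdef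
  have hchar : characterSeries π g =
      (1 - MvPowerSeries.X 0 * MvPowerSeries.X 1) * sepSeries A B := by
    rw [sub_mul, one_mul, mul_assoc, X_one_mul_sepSeries, X_zero_mul_sepSeries]
    ext s
    rw [map_sub, coeff_sepSeries, coeff_sepSeries]
    change LinearMap.trace ℂ _ (π (s 0) (s 1) g) = _
    have hconj : LinearMap.trace ℂ _ (π (s 0) (s 1) g) =
        LinearMap.trace ℂ _ (π (s 0) (s 1) D) := by
      rw [hgc, map_mul, LinearMap.trace_mul_comm, ← map_mul, inv_mul_cancel_left]
    rw [hconj, trace_diagonal (hπ _ _) D d hD, hAdef, hBdef, PowerSeries.coeff_mk,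
      PowerSeries.coeff_mk]
    congr 1
    rcases s 0 with _ | m
    · simp
    · rcases s 1 with _ | n
      · simp
      · simp [PowerSeries.coeff_succ_X_mul]
  rw [hchar, mul_left_comm, mul_assoc, cubicSeries_one_mul_sepSeries,
    cubicSeries_zero_mul_sepSeries, hA, hB, sepSeries_one_one, mul_one]

/-! ### Characters of finite groups -/

section FiniteGroup

open Representation

variable {G : Type*} [Group G]

theorem isIrreducible_of_forall {W : Type*} [AddCommGroup W] [Module ℂ W] [Nontrivial W]
    {ρ : Representation ℂ G W}
    (h : ∀ p : Submodule ℂ W, (∀ g, ∀ v ∈ p, ρ g v ∈ p) → p = ⊥ ∨ p = ⊤) : ρ.IsIrreducible where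
  exists_pair_ne := ⟨⊥, ⊤, fun h => bot_ne_top (congrArg Subrepresentation.toSubmodule h)⟩
  eq_bot_or_eq_top p := by
    rcases h p.toSubmodule fun g v hv => p.apply_mem_toSubmodule g hv with h | h
    · exact .inl (Subrepresentation.toSubmodule_injective h)
    · exact .inr (Subrepresentation.toSubmodule_injective h)

theorem nontrivial_of_isIrreducible {W : Type*} [AddCommGroup W] [Module ℂ W]
    {ρ : Representation ℂ G W} (h : ρ.IsIrreducible) : Nontrivial W := by
  by_contra hW
  rw [not_nontrivial_iff_subsingleton] at hW
  obtain ⟨p, q, hpq⟩ := h.exists_pair_ne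
  exact hpq (Subrepresentation.toSubmodule_injective (Subsingleton.elim _ _))

/-- The transport of a representation along a linear equivalence. -/
def transportRep {W W' : Type*} [AddCommGroup W] [Module ℂ W] [AddCommGroup W'] [Module ℂ W']
    (ρ : Representation ℂ G W) (e : W ≃ₗ[ℂ] W') : Representation ℂ G W' where
  toFun g := e.conj (ρ g)
  map_one' := by ext; simp [LinearEquiv.conj_apply]
  map_mul' g h := by ext; simp [LinearEquiv.conj_apply]

variable {l : ℕ} {U : Fin (l + 1) → Type*} [∀ i, AddCommGroup (U i)] [∀ i, Module ℂ (U i)]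
  {γ : ∀ i, Representation ℂ G (U i)}

theorem IsIrrepList.exists_equiv (hγ : IsIrrepList γ) {W : Type*} [AddCommGroup W] [Module ℂ W]
    [FiniteDimensional ℂ W] {ρ : Representation ℂ G W} (hρ : ρ.IsIrreducible) :
    ∃ i, Nonempty ((γ i).Equiv ρ) := by
  let e := (Module.finBasis ℂ W).equivFun
  have hW := nontrivial_of_isIrreducible hρ
  have : Nontrivial (Fin (Module.finrank ℂ W) → ℂ) := e.symm.toEquiv.nontrivial
  have hirr : (transportRep ρ e).IsIrreducible := by
    refine isIrreducible_of_forall fun p hp => ?_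
    rcases eq_bot_or_eq_top_of_isIrreducible hρ (p.comap e.toLinearMap) (fun g v hv => by
      have := hp g (e v) hv
      simpa [transportRep, LinearEquiv.conj_apply] using this) with h | h
    · left
      rw [← Submodule.map_comap_eq_of_surjective (f := e.toLinearMap) e.surjective p, h,
        Submodule.map_bot]
    · right
      rw [← Submodule.map_comap_eq_of_surjective (f := e.toLinearMap) e.surjective p, h,
        Submodule.map_top, LinearMap.range_eq_top]
      exact e.surjective
  obtain ⟨i, ⟨φ⟩⟩ := hγ.exhaustive _ _ hirr
  refine ⟨i, ⟨((Representation.Equiv.mk e fun g => ?_).trans φ).symm⟩⟩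
  ext v
  simp [transportRep, LinearEquiv.conj_apply]

/-- The inclusion of a subrepresentation. -/
def subrepInclusion {W : Type*} [AddCommGroup W] [Module ℂ W] {ρ : Representation ℂ G W}
    (p : Subrepresentation ρ) : IntertwiningMap p.toRepresentation ρ where
  toLinearMap := p.toSubmodule.subtype
  isIntertwining' g := by ext; rfl

/-- A nonzero finite dimensional representation contains one of the irreducible ones, by induction
on its dimension. -/
theorem IsIrrepList.exists_intertwiningMap_injective (hγ : IsIrrepList γ) {W : Type*}
    [AddCommGroup W] [Module ℂ W] [FiniteDimensional ℂ W] [Nontrivial W]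
    (ρ : Representation ℂ G W) : ∃ i, ∃ f : IntertwiningMap (γ i) ρ, Function.Injective f := by
  induction hd : Module.finrank ℂ W using Nat.strong_induction_on generalizing W with
  | _ d ih =>
    by_cases h : ρ.IsIrreducible
    · obtain ⟨i, ⟨φ⟩⟩ := hγ.exists_equiv h
      exact ⟨i, φ.toIntertwiningMap, φ.toLinearEquiv.injective⟩
    · have hex : ∃ p : Submodule ℂ W, (∀ g, ∀ v ∈ p, ρ g v ∈ p) ∧ p ≠ ⊥ ∧ p ≠ ⊤ := by
        by_contra hno
        push Not at hno
        exact h (isIrreducible_of_forall fun p hp => or_iff_not_imp_left.2 (hno p hp))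
      obtain ⟨p, hp, hbot, htop⟩ := hex
      let q : Subrepresentation ρ := ⟨p, fun g v hv => hp g v hv⟩
      have : Nontrivial q.toSubmodule := Submodule.nontrivial_iff_ne_bot.2 hbot
      obtain ⟨i, f, hf⟩ := ih _ (hd ▸ Submodule.finrank_lt htop)
        q.toRepresentation rfl
      exact ⟨i, (subrepInclusion q).comp f, fun v w h => hf (Subtype.ext h)⟩

/-- A submodule containing the images of all the intertwining maps from the irreducible
representations is everything, by Maschke's theorem. -/
theorem IsIrrepList.eq_top_of_forall_mem [Finite G] (hγ : IsIrrepList γ) {W : Type*}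
    [AddCommGroup W] [Module ℂ W] [FiniteDimensional ℂ W] (ρ : Representation ℂ G W)
    (p : Submodule ℂ W) (hp : ∀ i (f : IntertwiningMap (γ i) ρ) v, f v ∈ p) : p = ⊤ := by
  let S : Set W := {w | ∃ i, ∃ f : IntertwiningMap (γ i) ρ, ∃ v, f v = w}
  let q : Subrepresentation ρ := ⟨Submodule.span ℂ S, fun g v hv => by
    have : Submodule.span ℂ S ≤ (Submodule.span ℂ S).comap (ρ g) := by
      rw [Submodule.span_le]
      rintro _ ⟨i, f, v, rfl⟩
      exact Submodule.subset_span ⟨i, f, γ i g v, IntertwiningMap.isIntertwining _ _ f g v⟩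
    exact this hv⟩
  have hqp : q.toSubmodule ≤ p := by
    refine Submodule.span_le.2 ?_
    rintro _ ⟨i, f, v, rfl⟩
    exact hp i f v
  have : NeZero (Nat.card G : ℂ) := ⟨Nat.cast_ne_zero.2 Nat.card_pos.ne'⟩
  obtain ⟨q', hq'⟩ := exists_isCompl q
  have hinf : q.toSubmodule ⊓ q'.toSubmodule = ⊥ := congrArg Subrepresentation.toSubmodule
    (disjoint_iff.1 hq'.disjoint)
  have hsup : q.toSubmodule ⊔ q'.toSubmodule = ⊤ := congrArg Subrepresentation.toSubmodule
    (codisjoint_iff.1 hq'.codisjoint)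
  have hbot : q'.toSubmodule = ⊥ := by
    by_contra hne
    have : Nontrivial q'.toSubmodule := Submodule.nontrivial_iff_ne_bot.2 hne
    obtain ⟨i, f, hf⟩ := hγ.exists_intertwiningMap_injective q'.toRepresentation
    have := nontrivial_of_isIrreducible (hγ.irreducible i)
    obtain ⟨v, hv⟩ := exists_ne (0 : U i)
    have h1 : (f v : W) ∈ q.toSubmodule ⊓ q'.toSubmodule :=
      ⟨Submodule.subset_span ⟨i, (subrepInclusion q').comp f, v, rfl⟩, (f v).2⟩
    rw [hinf, Submodule.mem_bot] at h1
    exact hv (hf (by rw [map_zero]; exact Subtype.ext h1))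
  rw [hbot, sup_bot_eq] at hsup
  exact top_le_iff.1 (hsup ▸ hqp)

/-- Schur's lemma for distinct representations of the list. -/
theorem IsIrrepList.eq_zero_of_ne (hγ : IsIrrepList γ) {i j : Fin (l + 1)} (hij : i ≠ j)
    (f : IntertwiningMap (γ i) (γ j)) : f = 0 := by
  have := hγ.irreducible i
  have := hγ.irreducible j
  rcases IsIrreducible.bijective_or_eq_zero f with h | h
  · exact absurd (hγ.injective i j ⟨f.ofBijective h⟩) hij
  · exact h

/-- Schur's lemma for the endomorphisms of a representation of the list. -/
theorem IsIrrepList.exists_eq_smul (hγ : IsIrrepList γ) {i : Fin (l + 1)}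
    (f : IntertwiningMap (γ i) (γ i)) : ∃ c : ℂ, ∀ v, f v = c • v := by
  have := hγ.irreducible i
  have := hγ.finiteDimensional i
  obtain ⟨c, hc⟩ := (IsIrreducible.algebraMap_intertwiningMap_bijective_of_isAlgClosed
    (ρ := γ i)).2 f
  exact ⟨c, fun v => by rw [← hc]; rfl⟩

open DirectSum in
/-- Every finite dimensional representation of a finite group is the direct sum of the irreducible
ones, taken with their multiplicities: bases of the spaces of intertwining maps
`γ i → ρ` assemble to an isomorphism. -/
theorem IsIrrepList.nonempty_equiv_directSum [Finite G] (hγ : IsIrrepList γ) {W : Type*}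
    [AddCommGroup W] [Module ℂ W] [FiniteDimensional ℂ W] (ρ : Representation ℂ G W) :
    Nonempty (ρ.Equiv (Representation.directSum
      (fun k : (Σ i : Fin (l + 1), Fin (repMultiplicity (γ i) ρ)) => γ k.1))) := by
  have := hγ.finiteDimensional
  let b : ∀ i, Module.Basis (Fin (repMultiplicity (γ i) ρ)) ℂ (IntertwiningMap (γ i) ρ) :=
    fun i => Module.finBasis ℂ _
  let κ := Σ i : Fin (l + 1), Fin (repMultiplicity (γ i) ρ)
  let Ψ : (⨁ k : κ, U k.1) →ₗ[ℂ] W := DirectSum.toModule ℂ κ W fun k => (b k.1 k.2).toLinearMap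
  have hΨ : ∀ k v, Ψ (DirectSum.lof ℂ κ (fun k => U k.1) k v) = b k.1 k.2 v := fun k v =>
    DirectSum.toModule_lof ..
  have hcomm : ∀ g, Ψ ∘ₗ (Representation.directSum (fun k : κ => γ k.1)) g = ρ g ∘ₗ Ψ := by
    intro g
    refine DirectSum.linearMap_ext _ fun k => ?_
    ext v
    simp only [LinearMap.comp_apply, Representation.directSum_apply, DirectSum.lmap_lof, hΨ]
    exact IntertwiningMap.isIntertwining _ _ (b k.1 k.2) g v
  have hsurj : LinearMap.range Ψ = ⊤ := by
    refine hγ.eq_top_of_forall_mem ρ _ fun i f v => ?_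
    rw [← (b i).sum_repr f, IntertwiningMap.sum_apply]
    refine Submodule.sum_mem _ fun a _ => ?_
    rw [IntertwiningMap.smul_apply]
    exact Submodule.smul_mem _ _ ⟨_, hΨ ⟨i, a⟩ v⟩
  -- a nonzero kernel would contain a copy of some `γ i`, whose components are scalars by Schur's
  -- lemma; they give a linear relation between the members of the basis `b i`
  have hinj : LinearMap.ker Ψ = ⊥ := by
    by_contra hne
    let q : Subrepresentation (Representation.directSum (fun k : κ => γ k.1)) :=
      ⟨LinearMap.ker Ψ, fun g v hv => by
        have h := LinearMap.congr_fun (hcomm g) v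
        rw [LinearMap.comp_apply, LinearMap.comp_apply, LinearMap.mem_ker.1 hv, map_zero] at h
        exact LinearMap.mem_ker.2 h⟩
    have : FiniteDimensional ℂ (⨁ k : κ, U k.1) := inferInstance
    have : Nontrivial q.toSubmodule := Submodule.nontrivial_iff_ne_bot.2 hne
    obtain ⟨i, f, hf⟩ := hγ.exists_intertwiningMap_injective q.toRepresentation
    let comp : ∀ k : κ, IntertwiningMap (γ i) (γ k.1) := fun k =>
      { toLinearMap := DirectSum.component ℂ κ (fun k => U k.1) k ∘ₗ
          (((subrepInclusion q).comp f).toLinearMap)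
        isIntertwining' := fun g => by
          ext v
          have h := IntertwiningMap.isIntertwining _ _ ((subrepInclusion q).comp f) g v
          simp only [LinearMap.comp_apply, IntertwiningMap.toLinearMap_apply]
          rw [h]
          simp
          rfl }
    have hcomp : ∀ k v, comp k v = (f v : ⨁ k : κ, U k.1) k := fun k v => rfl
    have hsum : ∀ v, ∑ k : κ, b k.1 k.2 (comp k v) = 0 := by
      intro v
      have h1 : Ψ (f v : ⨁ k : κ, U k.1) = 0 := (f v).2
      rw [← h1]
      conv_rhs => rw [← DirectSum.sum_univ_of (f v : ⨁ k : κ, U k.1), map_sum]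
      exact Finset.sum_congr rfl fun k _ => (hΨ k _).symm
    have hsc : ∀ a, ∃ c : ℂ, ∀ v, comp ⟨i, a⟩ v = c • v := fun a =>
      hγ.exists_eq_smul (comp ⟨i, a⟩)
    choose c hc using hsc
    have hrel : ∑ a, c a • b i a = 0 := by
      ext v
      have h := hsum v
      rw [Fintype.sum_sigma, Finset.sum_eq_single i] at h
      · simp only [hc, map_smul] at h
        simpa [IntertwiningMap.sum_apply] using h
      · intro j _ hj
        refine Finset.sum_eq_zero fun a _ => ?_
        rw [hγ.eq_zero_of_ne hj.symm (comp ⟨j, a⟩)]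
        simp
      · simp
    have hc0 := Fintype.linearIndependent_iff.1 (b i).linearIndependent c hrel
    have hf0 : ∀ v, f v = 0 := by
      intro v
      refine Subtype.ext (DFinsupp.ext fun k => ?_)
      rw [← hcomp]
      obtain ⟨j, a⟩ := k
      by_cases hj : i = j
      · subst hj
        rw [hc, hc0, zero_smul]
        rfl
      · rw [hγ.eq_zero_of_ne hj (comp ⟨j, a⟩)]
        rfl
    have := nontrivial_of_isIrreducible (hγ.irreducible i)
    obtain ⟨v, hv⟩ := exists_ne (0 : U i)
    exact hv (hf ((hf0 v).trans (hf0 0).symm))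
  exact ⟨(Representation.Equiv.mk (LinearEquiv.ofBijective Ψ
    ⟨LinearMap.ker_eq_bot.1 hinj, LinearMap.range_eq_top.1 hsurj⟩) hcomm).symm⟩

theorem conjClasses_mk_conj (g h : G) : ConjClasses.mk (h * g * h⁻¹) = ConjClasses.mk g :=
  ConjClasses.mk_eq_mk_iff_isConj.2 (isConj_iff.2 ⟨h⁻¹, by group⟩)

theorem character_eq_of_mk_eq {W : Type*} [AddCommGroup W] [Module ℂ W]
    (ρ : Representation ℂ G W) {g h : G} (hgh : ConjClasses.mk g = ConjClasses.mk h) :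
    ρ.character g = ρ.character h := by
  obtain ⟨c, hc⟩ := isConj_iff.1 (ConjClasses.mk_eq_mk_iff_isConj.1 hgh)
  rw [← hc, char_conj]

theorem mk_inv_eq_of_mk_eq {g h : G} (hgh : ConjClasses.mk g = ConjClasses.mk h) :
    ConjClasses.mk g⁻¹ = ConjClasses.mk h⁻¹ := by
  obtain ⟨c, hc⟩ := isConj_iff.1 (ConjClasses.mk_eq_mk_iff_isConj.1 hgh)
  exact ConjClasses.mk_eq_mk_iff_isConj.2 (isConj_iff.2 ⟨c, by rw [← hc]; group⟩)

section Characters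
variable [Fintype G]

open Classical in
/-- Orthonormality of the irreducible characters. -/
theorem IsIrrepList.sum_character_mul (hγ : IsIrrepList γ) (i j : Fin (l + 1)) :
    (Nat.card G : ℂ)⁻¹ * ∑ g : G, (γ i).character g * (γ j).character g⁻¹ =
      if i = j then 1 else 0 := by
  have := hγ.irreducible
  have := hγ.finiteDimensional
  have : Invertible (Nat.card G : ℂ) := invertibleOfNonzero (Nat.cast_ne_zero.2 Nat.card_pos.ne')
  rw [char_orthonormal (γ i) (γ j)]
  congr 1
  rw [eq_iff_iff]
  constructor
  · exact fun h => (hγ.injective _ _ h).symm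
  · rintro rfl
    exact ⟨Representation.Equiv.refl _⟩

/-- A class function orthogonal to all the irreducible characters vanishes: it acts by zero on
each irreducible representation, by Schur's lemma, hence on the regular representation. -/
theorem IsIrrepList.eq_zero_of_sum_mul_character (hγ : IsIrrepList γ) (F : G → ℂ)
    (hF : ∀ g h, F (h * g * h⁻¹) = F g) (h0 : ∀ i, ∑ g, F g * (γ i).character g = 0) :
    F = 0 := by
  have hzero : ∀ i v, ∑ g, F g • γ i g v = 0 := by
    intro i
    have := hγ.finiteDimensional i
    let T : IntertwiningMap (γ i) (γ i) :=
      { toLinearMap := ∑ g, F g • γ i g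
        isIntertwining' := fun h => by
          ext v
          simp only [LinearMap.comp_apply, LinearMap.sum_apply, LinearMap.smul_apply, map_sum,
            map_smul]
          refine Fintype.sum_equiv (MulAut.conj h⁻¹).toEquiv _ _ fun g => ?_
          have e1 : F (h⁻¹ * g * h) = F g := by simpa using hF g h⁻¹
          simp only [MulEquiv.toEquiv_eq_coe, MulEquiv.coe_toEquiv, MulAut.conj_apply, inv_inv]
          rw [e1, ← Module.End.mul_apply, ← Module.End.mul_apply, ← map_mul, ← map_mul]
          congr 3
          group }
    have hT : ∀ v, T v = ∑ g, F g • γ i g v := fun v => by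
      change (∑ g, F g • γ i g) v = _
      simp
    obtain ⟨c, hc⟩ := hγ.exists_eq_smul T
    have htr : c * Module.finrank ℂ (U i) = 0 := by
      rw [← h0 i, ← LinearMap.trace_id ℂ (U i), ← smul_eq_mul, ← map_smul]
      have : c • LinearMap.id = ∑ g, F g • γ i g := by
        ext v
        rw [LinearMap.smul_apply, LinearMap.id_apply, ← hc]
        rfl
      rw [this, map_sum]
      simp [Representation.character]
    have := nontrivial_of_isIrreducible (hγ.irreducible i)
    have hc0 : c = 0 := (mul_eq_zero.1 htr).resolve_right
      (Nat.cast_ne_zero.2 Module.finrank_pos.ne')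
    intro v
    rw [← hT, hc, hc0, zero_smul]
  let R : Representation ℂ G (G → ℂ) :=
    { toFun := fun g => LinearMap.funLeft ℂ ℂ fun h => g⁻¹ * h
      map_one' := by ext; simp [LinearMap.funLeft]
      map_mul' := fun g g' => by
        refine LinearMap.ext fun F => funext fun h => ?_
        simp [LinearMap.funLeft_apply, mul_assoc] }
  have hreg : LinearMap.ker (∑ g, F g • R g) = ⊤ := by
    refine hγ.eq_top_of_forall_mem R _ fun i f v => ?_
    rw [LinearMap.mem_ker, LinearMap.sum_apply]
    simp only [LinearMap.smul_apply, ← IntertwiningMap.isIntertwining _ _ f]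
    have h := congrArg f (hzero i v)
    rw [map_sum, map_zero] at h
    rw [← h]
    exact Finset.sum_congr rfl fun g _ => (map_smul f _ _).symm
  classical
  funext g
  have h1 : (∑ g, F g • R g) (Pi.single 1 1) = 0 :=
    LinearMap.mem_ker.1 (hreg ▸ Submodule.mem_top)
  have h2 := congrFun h1 g
  have hR : ∀ x, R x (Pi.single 1 1) g = if x = g then 1 else 0 := by
    intro x
    change (Pi.single 1 1 : G → ℂ) (x⁻¹ * g) = _
    rw [Pi.single_apply]
    simp only [inv_mul_eq_one]
  simpa [LinearMap.sum_apply, Finset.sum_apply, hR] using h2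

/-- There are as many conjugacy classes as irreducible representations: pairing with the
irreducible characters is an isomorphism from the class functions to `ℂ ^ (l + 1)`. -/
theorem IsIrrepList.card_conjClasses (hγ : IsIrrepList γ) : Nat.card (ConjClasses G) = l + 1 := by
  classical
  let T : (ConjClasses G → ℂ) →ₗ[ℂ] (Fin (l + 1) → ℂ) :=
    { toFun := fun F i => ∑ g, F (ConjClasses.mk g) * (γ i).character g
      map_add' := fun F F' => by ext; simp [add_mul, Finset.sum_add_distrib]
      map_smul' := fun c F => by ext; simp [mul_assoc, Finset.mul_sum] }
  have hinj : LinearMap.ker T = ⊥ := by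
    rw [eq_bot_iff]
    intro F hF
    have h := hγ.eq_zero_of_sum_mul_character (fun g => F (ConjClasses.mk g))
      (fun g h => by rw [conjClasses_mk_conj]) (fun i => congrFun (LinearMap.mem_ker.1 hF) i)
    rw [Submodule.mem_bot]
    funext c
    obtain ⟨g, rfl⟩ := ConjClasses.exists_rep c
    exact congrFun h g
  have hsurj : LinearMap.range T = ⊤ := by
    rw [eq_top_iff, ← (Pi.basisFun ℂ (Fin (l + 1))).span_eq, Submodule.span_le]
    rintro _ ⟨j, rfl⟩
    choose r hr using ConjClasses.exists_rep (α := G)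
    refine ⟨fun c => (Nat.card G : ℂ)⁻¹ * (γ j).character (r c)⁻¹, ?_⟩
    funext i
    change ∑ g, (Nat.card G : ℂ)⁻¹ * (γ j).character (r (ConjClasses.mk g))⁻¹ *
      (γ i).character g = _
    rw [Pi.basisFun_apply, Pi.single_apply, ← hγ.sum_character_mul i j, Finset.mul_sum]
    refine Finset.sum_congr rfl fun g _ => ?_
    rw [character_eq_of_mk_eq (γ j) (mk_inv_eq_of_mk_eq (hr (ConjClasses.mk g)))]
    ring
  have h := (LinearEquiv.ofBijective T
    ⟨LinearMap.ker_eq_bot.1 hinj, LinearMap.range_eq_top.1 hsurj⟩).finrank_eq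
  rwa [Module.finrank_pi, Module.finrank_pi, Fintype.card_fin, ← Nat.card_eq_fintype_card] at h

open Classical in
/-- The size of the conjugacy class of an element. -/
def classSize (x : G) : ℕ :=
  (Finset.univ.filter fun y : G => ConjClasses.mk y = ConjClasses.mk x).card

theorem sum_eq_sum_classSize {M ι : Type*} [AddCommMonoid M] [Fintype ι] (F : G → M)
    (hF : ∀ x y, ConjClasses.mk x = ConjClasses.mk y → F x = F y) {g : ι → G}
    (hg : Function.Bijective fun j => ConjClasses.mk (g j)) :
    ∑ x, F x = ∑ j, classSize (g j) • F (g j) := by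
  classical
  have h := Finset.sum_fiberwise Finset.univ (fun x : G => (Equiv.ofBijective _ hg).symm
    (ConjClasses.mk x)) F
  rw [← h]
  refine Finset.sum_congr rfl fun j _ => ?_
  have h1 : (Finset.univ.filter fun x : G => (Equiv.ofBijective _ hg).symm (ConjClasses.mk x) = j) =
      Finset.univ.filter fun x : G => ConjClasses.mk x = ConjClasses.mk (g j) := by
    ext x
    simp [_root_.Equiv.symm_apply_eq]
  rw [h1, classSize]
  rw [Finset.sum_congr rfl fun x hx => hF x (g j) (Finset.mem_filter.1 hx).2, Finset.sum_const]

/-- The inverse of the character table, given by the orthogonality relations. -/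
def charTableInv (γ : ∀ i, Representation ℂ G (U i)) (g : Fin (l + 1) → G) :
    Matrix (Fin (l + 1)) (Fin (l + 1)) ℂ :=
  Matrix.of fun j k => (classSize (g j) / Nat.card G : ℂ) * (γ k).character (g j)⁻¹

theorem IsIrrepList.charTable_mul_charTableInv (hγ : IsIrrepList γ) {g : Fin (l + 1) → G}
    (hg : Function.Bijective fun j => ConjClasses.mk (g j)) :
    charTable γ g * charTableInv γ g = 1 := by
  classical
  ext i k
  rw [Matrix.mul_apply, Matrix.one_apply, ← hγ.sum_character_mul i k,
    sum_eq_sum_classSize _ (fun x y h => by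
      rw [character_eq_of_mk_eq _ h, character_eq_of_mk_eq (γ k) (mk_inv_eq_of_mk_eq h)]) hg,
    Finset.mul_sum]
  refine Finset.sum_congr rfl fun j _ => ?_
  simp only [charTable, charTableInv, Matrix.of_apply, nsmul_eq_mul]
  ring

/-- Triviality of `γ 0` says that `G` acts as the identity; orthonormality of the characters then
gives `(dim γ 0) ^ 2 = 1`. -/
theorem IsIrrepList.character_zero (hγ : IsIrrepList γ) (g : G) : (γ 0).character g = 1 := by
  have := hγ.finiteDimensional 0
  have := hγ.trivial_zero
  have hid : ∀ g, γ 0 g = LinearMap.id := fun g => LinearMap.ext fun v =>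
    (γ 0).isTrivial_apply g v
  have hconst : ∀ g, (γ 0).character g = Module.finrank ℂ (U 0) := fun g => by
    rw [Representation.character, hid, LinearMap.trace_id]
  have h := hγ.sum_character_mul 0 0
  simp only [hconst, Finset.sum_const, Finset.card_univ, nsmul_eq_mul, if_true] at h
  rw [← Nat.card_eq_fintype_card, inv_mul_cancel_left₀ (Nat.cast_ne_zero.2 Nat.card_pos.ne')] at h
  have h1 : Module.finrank ℂ (U 0) = 1 := by
    have : Module.finrank ℂ (U 0) * Module.finrank ℂ (U 0) = 1 := by exact_mod_cast h
    exact Nat.eq_one_of_mul_eq_one_right this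
  rw [hconst, h1, Nat.cast_one]

/-- The multiplicity of an irreducible representation as a pairing of characters. -/
theorem IsIrrepList.repMultiplicity_eq (hγ : IsIrrepList γ) {W : Type*} [AddCommGroup W]
    [Module ℂ W] [FiniteDimensional ℂ W] (ρ : Representation ℂ G W) (i : Fin (l + 1)) :
    (repMultiplicity (γ i) ρ : ℂ) =
      (Nat.card G : ℂ)⁻¹ * ∑ g, (γ i).character g * ρ.character g⁻¹ := by
  have := hγ.finiteDimensional i
  have : Invertible (Nat.card G : ℂ) := invertibleOfNonzero (Nat.cast_ne_zero.2 Nat.card_pos.ne')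
  rw [repMultiplicity, ← card_inv_mul_sum_char_mul_char_eq_finrank]
  congr 1
  refine Fintype.sum_equiv (_root_.Equiv.inv G) _ _ fun g => ?_
  simp [mul_comm]

end Characters
end FiniteGroup

/-! ### The matrix formula -/

theorem ratFunToSeriesFrac_algebraMap (p : MvPolynomial (Fin 2) ℂ) :
    ratFunToSeriesFrac (algebraMap _ RatFun2 p) =
      algebraMap (MvPowerSeries (Fin 2) ℂ) SeriesFrac2 (p : MvPowerSeries (Fin 2) ℂ) :=
  IsLocalization.map_eq
    (nonZeroDivisors_le_comap_nonZeroDivisors_of_injective _ coeToMvPowerSeries_injective) p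

theorem ratFunToSeriesFrac_const (c : ℂ) :
    ratFunToSeriesFrac (algebraMap ℂ RatFun2 c) =
      algebraMap (MvPowerSeries (Fin 2) ℂ) SeriesFrac2 (MvPowerSeries.C c) := by
  rw [IsScalarTower.algebraMap_apply ℂ (MvPolynomial (Fin 2) ℂ) RatFun2,
    ratFunToSeriesFrac_algebraMap, MvPolynomial.algebraMap_eq, MvPolynomial.coe_C]

theorem constantCoeff_cubicSeries (i : Fin 2) (c₁ c₂ : ℂ) :
    MvPowerSeries.constantCoeff (cubicSeries i c₁ c₂) = 1 := by
  simp [cubicSeries]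

/-- A power series that solves the equation defining `ratF d₁ d₂` is its expansion. -/
theorem algebraMap_eq_ratF {P : MvPowerSeries (Fin 2) ℂ} {d₁ d₂ : ℂ}
    (h : cubicSeries 0 d₁ d₂ * cubicSeries 1 d₂ d₁ * P =
      1 - MvPowerSeries.X 0 * MvPowerSeries.X 1) :
    algebraMap (MvPowerSeries (Fin 2) ℂ) SeriesFrac2 P = ratFunToSeriesFrac (ratF d₁ d₂) := by
  have hne : cubicSeries 0 d₁ d₂ * cubicSeries 1 d₂ d₁ ≠ 0 := by
    intro h0
    have h1 := congrArg MvPowerSeries.constantCoeff h0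
    simp [constantCoeff_cubicSeries] at h1
  have hne' : algebraMap (MvPowerSeries (Fin 2) ℂ) SeriesFrac2
      (cubicSeries 0 d₁ d₂ * cubicSeries 1 d₂ d₁) ≠ 0 := by
    rwa [Ne, map_eq_zero_iff _ (IsFractionRing.injective _ _)]
  simp only [ratF, map_div₀, map_mul, map_sub, map_add, map_one, map_pow,
    ratFunToSeriesFrac_algebraMap, ratFunToSeriesFrac_const, MvPolynomial.coe_X]
  simp only [← map_mul, ← map_sub, ← map_add, ← map_pow,
    ← map_one (algebraMap (MvPowerSeries (Fin 2) ℂ) SeriesFrac2)]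
  simp only [cubicSeries] at h hne'
  rw [eq_div_iff hne', ← map_mul, mul_comm P]
  exact congrArg _ h

theorem trace_inv_eq_conj {g : SL(3, ℂ)} (hg : IsOfFinOrder g) :
    (g⁻¹).1.trace = starRingEnd ℂ g.1.trace := by
  obtain ⟨P, D, d, hD, hgP, hd⟩ := exists_conj_diagonal hg
  have hgc : g = P * D * P⁻¹ := by rw [← hgP, mul_inv_cancel_right]
  have hdi : ∀ i, d i * starRingEnd ℂ (d i) = 1 := fun i => by
    rw [Complex.mul_conj, Complex.normSq_eq_norm_sq, hd]; simp
  have hDinv : (D⁻¹).1 = Matrix.diagonal fun i => starRingEnd ℂ (d i) := by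
    have h1 : D.1 * (D⁻¹).1 = 1 := by
      rw [← Matrix.SpecialLinearGroup.coe_mul, mul_inv_cancel]; rfl
    have h2 : (Matrix.diagonal fun i => starRingEnd ℂ (d i)) * D.1 = 1 := by
      rw [hD, Matrix.diagonal_mul_diagonal]
      simp only [mul_comm, hdi, Matrix.diagonal_one]
    exact (left_inv_eq_right_inv h2 h1).symm
  have h1 : g⁻¹ = P * D⁻¹ * P⁻¹ := by rw [hgc]; group
  rw [h1, Matrix.SpecialLinearGroup.coe_mul, Matrix.trace_mul_comm,
    ← Matrix.SpecialLinearGroup.coe_mul, inv_mul_cancel_left, hDinv, Matrix.trace_diagonal, hgc,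
    Matrix.SpecialLinearGroup.coe_mul (P * D), Matrix.trace_mul_comm,
    ← Matrix.SpecialLinearGroup.coe_mul, inv_mul_cancel_left, hD, Matrix.trace_diagonal, map_sum]

section
variable {V : ℕ → ℕ → Type*} [∀ m n, AddCommGroup (V m n)] [∀ m n, Module ℂ (V m n)]
  {π : ∀ m n, Representation ℂ SL(3, ℂ) (V m n)}

theorem algebraMap_characterSeries (hπ : ∀ m n, IsSimpleOfHighestWeight (π m n) m n)
    {Γ : Subgroup SL(3, ℂ)} [Finite Γ] (g : Γ) :
    algebraMap (MvPowerSeries (Fin 2) ℂ) SeriesFrac2 (characterSeries π (g⁻¹ : Γ).1) =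
      ratFunToSeriesFrac
        (ratF (starRingEnd ℂ (naturalCharacter Γ g)) (naturalCharacter Γ g)) := by
  have hfin : ∀ x : Γ, IsOfFinOrder x.1 := fun x =>
    Γ.subtype.isOfFinOrder (isOfFinOrder_of_finite x)
  refine algebraMap_eq_ratF ?_
  have h := characterSeries_eq hπ (hfin g⁻¹)
  have h1 : (g⁻¹ : Γ).1.1.trace = starRingEnd ℂ (naturalCharacter Γ g) :=
    trace_inv_eq_conj (hfin g)
  rwa [h1, Complex.conj_conj] at h

variable {Γ : Subgroup SL(3, ℂ)} {l : ℕ} {U : Fin (l + 1) → Type*}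
  [∀ i, AddCommGroup (U i)] [∀ i, Module ℂ (U i)] {γ : ∀ i, Representation ℂ Γ (U i)}

/-- The pairing of characters that computes the multiplicities, summed over all `m` and `n`. -/
theorem multSeries_eq [Fintype Γ] (hγ : IsIrrepList γ)
    (hπ : ∀ m n, IsSimpleOfHighestWeight (π m n) m n) (i : Fin (l + 1)) :
    multSeries Γ γ π i = ∑ x : Γ, MvPowerSeries.C ((Nat.card Γ : ℂ)⁻¹ * (γ i).character x) *
      characterSeries π (x⁻¹ : Γ).1 := by
  ext s
  have := (hπ (s 0) (s 1)).finiteDimensional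
  rw [map_sum]
  simp only [MvPowerSeries.coeff_C_mul]
  change (repMultiplicity (γ i) (restrictRep Γ (π (s 0) (s 1))) : ℂ) = _
  rw [hγ.repMultiplicity_eq, Finset.mul_sum]
  refine Finset.sum_congr rfl fun x _ => ?_
  rw [mul_assoc]
  rfl

/-- The constant coefficient of `characterSeries_eq`. -/
theorem character_zero_zero (hπ : ∀ m n, IsSimpleOfHighestWeight (π m n) m n) {g : SL(3, ℂ)}
    (hg : IsOfFinOrder g) : (π 0 0).character g = 1 := by
  have h := congrArg MvPowerSeries.constantCoeff (characterSeries_eq hπ hg)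
  simp only [map_mul, constantCoeff_cubicSeries, one_mul, map_sub, map_one,
    MvPowerSeries.constantCoeff_X, mul_zero, sub_zero] at h
  exact h

theorem multVector_zero_zero [Finite Γ] (hγ : IsIrrepList γ)
    (hπ : ∀ m n, IsSimpleOfHighestWeight (π m n) m n) :
    multVector Γ γ π 0 0 = Pi.single 0 1 := by
  have := Fintype.ofFinite Γ
  have := (hπ 0 0).finiteDimensional
  funext i
  have h : (multVector Γ γ π 0 0 i : ℂ) = if i = 0 then 1 else 0 := by
    rw [multVector, hγ.repMultiplicity_eq, ← hγ.sum_character_mul i 0]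
    congr 1
    refine Finset.sum_congr rfl fun x _ => ?_
    rw [hγ.character_zero]
    congr 1
    exact character_zero_zero hπ
      (Γ.subtype.isOfFinOrder (isOfFinOrder_of_finite x⁻¹))
  rw [Pi.single_apply]
  split_ifs at h ⊢ <;> exact_mod_cast h

theorem constMatrix_mul (A B : Matrix (Fin (l + 1)) (Fin (l + 1)) ℂ) :
    constMatrix (A * B) = constMatrix A * constMatrix B :=
  Matrix.map_mul

/-- The matrix formula for the generating function of the multiplicities. The column of `T⁻¹` of
index `0` has the entries `classSize (g j) / |Γ|`, so the right hand side is `multSeries_eq` with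
the sum over the group collected over conjugacy classes. -/
theorem algebraMap_multSeries [Finite Γ] (hγ : IsIrrepList γ)
    (hπ : ∀ m n, IsSimpleOfHighestWeight (π m n) m n) {g : Fin (l + 1) → Γ}
    (hg : Function.Bijective fun j => ConjClasses.mk (g j)) (i : Fin (l + 1)) :
    algebraMap (MvPowerSeries (Fin 2) ℂ) SeriesFrac2 (multSeries Γ γ π i) =
      ratFunToSeriesFrac
        (((constMatrix (charTable γ g) * deltaMatrix Γ g * constMatrix (charTable γ g)⁻¹).mulVec
          (fun k => (multVector Γ γ π 0 0 k : RatFun2))) i) := by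
  have := Fintype.ofFinite Γ
  have hinv : (charTable γ g)⁻¹ = charTableInv γ g :=
    Matrix.inv_eq_right_inv (hγ.charTable_mul_charTableInv hg)
  have hv : (fun k => (multVector Γ γ π 0 0 k : RatFun2)) = Pi.single 0 1 := by
    rw [multVector_zero_zero hγ hπ]
    funext k
    rw [Pi.single_apply, Pi.single_apply]
    split_ifs <;> simp
  rw [hv, Matrix.mulVec_single_one, Matrix.col_apply, Matrix.mul_apply, map_sum, hinv,
    multSeries_eq hγ hπ, sum_eq_sum_classSize _ (fun x y hxy => by
      obtain ⟨c, hc⟩ := isConj_iff.1 (ConjClasses.mk_eq_mk_iff_isConj.1 hxy)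
      rw [character_eq_of_mk_eq (γ i) hxy, ← hc]
      congr 1
      ext s
      have h1 : ((c * x * c⁻¹)⁻¹ : Γ).1 = c.1 * (x⁻¹ : Γ).1 * c.1⁻¹ := by
        simp [mul_assoc]
      rw [h1]
      exact ((π (s 0) (s 1)).char_conj _ _).symm) hg, map_sum]
  refine Finset.sum_congr rfl fun j _ => ?_
  rw [deltaMatrix, Matrix.mul_diagonal, map_mul ratFunToSeriesFrac,
    map_mul ratFunToSeriesFrac, ← algebraMap_characterSeries hπ]
  simp only [constMatrix, Matrix.map_apply, ratFunToSeriesFrac_const, ← map_mul]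
  congr 1
  simp only [charTable, charTableInv, Matrix.of_apply, hγ.character_zero, mul_one, nsmul_eq_mul,
    div_eq_mul_inv, map_mul, map_natCast]
  ring

theorem isRationalSeries_of_eq {P : MvPowerSeries (Fin 2) ℂ} {x : RatFun2}
    (h : algebraMap (MvPowerSeries (Fin 2) ℂ) SeriesFrac2 P = ratFunToSeriesFrac x) :
    IsRationalSeries P := by
  obtain ⟨N, D, hD, rfl⟩ := IsFractionRing.div_surjective (A := MvPolynomial (Fin 2) ℂ) x
  have hD0 : D ≠ 0 := nonZeroDivisors.ne_zero hD
  refine ⟨N, D, hD0, IsFractionRing.injective (MvPowerSeries (Fin 2) ℂ) SeriesFrac2 ?_⟩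
  have hD1 : algebraMap (MvPowerSeries (Fin 2) ℂ) SeriesFrac2
      (D : MvPowerSeries (Fin 2) ℂ) ≠ 0 := by
    rw [Ne, map_eq_zero_iff _ (IsFractionRing.injective _ _)]
    exact fun h0 => hD0 (coeToMvPowerSeries_injective (h0.trans (map_zero _).symm))
  rw [map_mul, h, map_div₀, ratFunToSeriesFrac_algebraMap, ratFunToSeriesFrac_algebraMap,
    mul_div_cancel₀ _ hD1]

end

end

theorem mainTheorem2 (Γ : Subgroup SL(3, ℂ)) [Finite Γ]
    {l : ℕ} {U : Fin (l + 1) → Type*} [∀ i, AddCommGroup (U i)] [∀ i, Module ℂ (U i)]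
    (γ : ∀ i, Representation ℂ Γ (U i)) (hγ : IsIrrepList γ)
    {V : ℕ → ℕ → Type*} [∀ m n, AddCommGroup (V m n)] [∀ m n, Module ℂ (V m n)]
    (π : ∀ m n, Representation ℂ SL(3, ℂ) (V m n))
    (hπ : ∀ m n, IsSimpleOfHighestWeight (π m n) m n) :
    -- complete reducibility: `π m n` restricted to `Γ` is the sum of the `γ i`, each taken
    -- `multVector Γ γ π m n i` times
    (∀ m n, Nonempty ((restrictRep Γ (π m n)).Equiv
      (Representation.directSum
        (fun k : (Σ i : Fin (l + 1), Fin (multVector Γ γ π m n i)) => γ k.1)))) ∧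
    multVector Γ γ π 0 0 = Pi.single 0 1 ∧
    -- rationality of each coordinate
    (∀ i, IsRationalSeries (multSeries Γ γ π i)) ∧
    -- there are as many conjugacy classes as irreducible representations, and the explicit
    -- formula holds for every choice of representatives of the conjugacy classes
    Nat.card (ConjClasses Γ) = l + 1 ∧
    ∀ g : Fin (l + 1) → Γ, Function.Bijective (fun j => ConjClasses.mk (g j)) →
      IsUnit (charTable γ g) ∧
      (∀ i, algebraMap (MvPowerSeries (Fin 2) ℂ) SeriesFrac2 (multSeries Γ γ π i) =
        ratFunToSeriesFrac
          (((constMatrix (charTable γ g) * deltaMatrix Γ g * constMatrix (charTable γ g)⁻¹).mulVec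
            (fun k => (multVector Γ γ π 0 0 k : RatFun2))) i)) ∧
      (∀ i, algebraMap (MvPowerSeries (Fin 2) ℂ) SeriesFrac2 (multSeries Γ γ π i) =
        ratFunToSeriesFrac
          (((constMatrix (charTable γ g) * deltaMatrix Γ g * constMatrix (charTable γ g)).mulVec
            ((constMatrix ((charTable γ g)⁻¹ ^ 2)).mulVec
              (fun k => (multVector Γ γ π 0 0 k : RatFun2)))) i)) := by
  have hcard : Nat.card (ConjClasses Γ) = l + 1 := by
    have := Fintype.ofFinite Γ
    exact hγ.card_conjClasses
  refine ⟨fun m n => ?_, multVector_zero_zero hγ hπ, fun i => ?_, hcard, fun g hg => ?_⟩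
  · have := (hπ m n).finiteDimensional
    exact hγ.nonempty_equiv_directSum (restrictRep Γ (π m n))
  · let e : Fin (l + 1) ≃ ConjClasses Γ := (Finite.equivFinOfCardEq hcard).symm
    choose r hr using ConjClasses.exists_rep (α := Γ)
    exact isRationalSeries_of_eq (algebraMap_multSeries hγ hπ (g := fun j => r (e j))
      (by simpa only [hr] using e.bijective) i)
  · have := Fintype.ofFinite Γ
    have hmul := hγ.charTable_mul_charTableInv hg
    have hunit : IsUnit (charTable γ g) := IsUnit.of_mul_eq_one _ hmul
    refine ⟨hunit, fun i => algebraMap_multSeries hγ hπ hg i, fun i => ?_⟩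
    rw [Matrix.mulVec_mulVec, mul_assoc, ← constMatrix_mul, pow_two, ← mul_assoc (charTable γ g),
      Matrix.mul_nonsing_inv _ ((Matrix.isUnit_iff_isUnit_det _).1 hunit), one_mul]
    exact algebraMap_multSeries hγ hπ hg i
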